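/- Let $F_0$ (in control) and $F_1$ (out of control) be known, mutually absolutely continuous probability laws on a measurable space, let $\ell=dF_1/dF_0$, and assume that the law of $\ell$ under $F_0$ has no atoms. On a measurable space $(\Omega,\mathcal F)$ let $X_1,X_2,\dots$ be the observations, $\mathcal F_t=\sigma(X_1,\dots,X_t)$ ($\mathcal F_0$ trivial), and let $\mathcal P$ be a set of probability measures under each of which the $X_t$ are independent with $\mathcal L(X_t)\in\{F_0,F_1\}$ for all $t$, such that every sequence of states in $\{0,1\}^{\mathbb N}$ occurs for some $P\in\mathcal P$ (the law may switch any number of times). A signal process $Z$ gives, at each time $t\ge 1$, an $\mathcal F_t$-measurable set $Z_t\subseteq\{0,1\}$ of signals ($0$: in control, $1$: out of control, $\emptyset$: no signal); it is single-valued if it never gives both signals at once, i.e. $Z_t\in\{\{0\},\{1\},\emptyset\}$. Let $\tau_n^j(Z)=\inf\{t\ge n: j\in Z_t\}$ and, for $j\in\{0,1\}$, $$\mathbf C^j(Z)=\sup_{n\ge1}\ \sup\{\operatorname{ess\,sup} E_P(\tau_n^j(Z)-n+1\mid\mathcal F_{n-1}) : P\in\mathcal P,\ \mathcal L(X_t)=F_j\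 \forall t\ge n\},$$ $$B^j(Z)=\inf_{n\ge1}\ \operatorname{ess\,sup} E_P(\tau_n^j(Z)-n+1\mid\mathcal F_{n-1}),\quad P\in\mathcal P\text{ with }\mathcal L(X_t)=F_{1-j}\ \forall t\ge1$$ ($B^j$ is the run length until a false signal $j$; it does not depend on the choice of $P$). Let $c_0,c_1>0$ satisfy $c_1>1/F_0(\ell>1)$ and $c_0>1/F_1(\ell<1)$. Call a feasible process in a given class (one with $B^0\ge c_0$ and $B^1\ge c_1$) a solution in that class if it minimises both $\mathbf C^1$ and $\mathbf C^0$ simultaneously among all feasible processes of the class. For $h>0$ let $R^L_t$ and $R^U_t$ be the charts $R_t=\min\{\max(R_{t-1}+\log\ell(X_t),0),h\}$ started at $R^L_0=0$ and $R^U_0=h$ respectively. Theorem. There exist constants $k_U>0$ and $k_L>0$ such that for every $h\ge\max(k_U,k_L)$: (i) the process that at time $t$ signals $0$ exactly when $R^U_t\le h-k_U$ and signals $1$ exactly when $R^L_t\ge k_L$ is a solution in the class of all signal processes; (ii) if moreover $h\le k_U+k_L$, the single-valued process with $Z^*_t=\{0\}$ if $R^U_t\le h-k_U$, otherwise $Z^*_t=\{1\}$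 if $R^L_t\ge k_L$, and otherwise $Z^*_t=\emptyset$, is a solution in the class of single-valued signal processes. -/

import Mathlib

open MeasureTheory ProbabilityTheory
open scoped ENNReal

namespace SignalDetection

variable {Ω 𝒳 : Type*} [MeasurableSpace Ω] [MeasurableSpace 𝒳]

/-- `F 0` is the in-control law and `F 1` the out-of-control law. Under `P` the observations
`X 1, X 2, …` are independent and each has law `F 0` or `F 1`. Times are `1, 2, …`;
`X 0` plays no role anywhere. -/
structure IsObservationLaw (F : Fin 2 → Measure 𝒳) (X : ℕ → Ω → 𝒳) (P : Measure Ω) : Prop where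
  isProbabilityMeasure : IsProbabilityMeasure P
  iIndepFun : iIndepFun (fun t : ℕ => X (t + 1)) P
  law : ∀ t, 1 ≤ t → ∃ j : Fin 2, P.map (X t) = F j

/-- `𝓜` is a set of laws of the observations in which every sequence of states occurs. -/
structure IsModel (F : Fin 2 → Measure 𝒳) (X : ℕ → Ω → 𝒳) (𝓜 : Set (Measure Ω)) : Prop where
  isObservationLaw : ∀ P ∈ 𝓜, IsObservationLaw F X P
  exists_law : ∀ s : ℕ → Fin 2, ∃ P ∈ 𝓜, ∀ t, 1 ≤ t → P.map (X t) = F (s t)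

/-- The σ-algebra generated by `X 1, …, X t` (trivial for `t = 0`). -/
abbrev obsSigma (X : ℕ → Ω → 𝒳) (t : ℕ) : MeasurableSpace Ω :=
  ⨆ s ∈ Finset.Icc 1 t, MeasurableSpace.comap (X s) inferInstance

/-- A signal process records at each time the set of signals given: `∅` is no signal, `{0}`
in-control, `{1}` out-of-control, and `{0, 1}` both at once. It is adapted to the observations. -/
def IsSignalProcess (X : ℕ → Ω → 𝒳) (Z : ℕ → Ω → Set (Fin 2)) : Prop :=
  ∀ t, 1 ≤ t → ∀ j : Fin 2, MeasurableSet[obsSigma X t] {ω | j ∈ Z t ω}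

/-- At no time are both signals given: the values are `∅`, `{0}`, `{1}` only. -/
def IsSingleSignal (Z : ℕ → Ω → Set (Fin 2)) : Prop :=
  ∀ t, 1 ≤ t → ∀ ω, (Z t ω).Subsingleton

/-- First time `t ≥ n` at which `Z` signals `j` (`⊤` if there is none). -/
noncomputable def firstSignal (Z : ℕ → Ω → Set (Fin 2)) (j : Fin 2) (n : ℕ) (ω : Ω) : ℕ∞ :=
  ⨅ (t : ℕ) (_ : n ≤ t ∧ j ∈ Z t ω), (t : ℕ∞)

/-- The waiting time `τ_n^j(Z) - n + 1`. -/
noncomputable def delay (Z : ℕ → Ω → Set (Fin 2)) (j : Fin 2) (n : ℕ) (ω : Ω) : ℝ≥0∞ :=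
  ((firstSignal Z j n ω - (n : ℕ∞) + 1 : ℕ∞) : ℝ≥0∞)

/-- `ess sup E (τ_n^j(Z) - n + 1 | X 1, …, X (n - 1))` under `P`. -/
noncomputable def worstMeanDelay (X : ℕ → Ω → 𝒳) (P : Measure Ω) (Z : ℕ → Ω → Set (Fin 2))
    (j : Fin 2) (n : ℕ) : ℝ≥0∞ :=
  essSup (condLExp (obsSigma X (n - 1)) P (delay Z j n)) P

/-- `C^j(Z)`: the worst mean delay in signalling `j`, over all times `n` and all laws under which
the observations have law `F j` from time `n` on. -/
noncomputable def worstDelay (F : Fin 2 → Measure 𝒳) (X : ℕ → Ω → 𝒳) (𝓜 : Set (Measure Ω))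
    (Z : ℕ → Ω → Set (Fin 2)) (j : Fin 2) : ℝ≥0∞ :=
  ⨆ (n : ℕ) (_ : 1 ≤ n) (P ∈ 𝓜) (_ : ∀ t, n ≤ t → P.map (X t) = F j), worstMeanDelay X P Z j n

/-- `B^j(Z)`: the run length until a signal `j` when all observations have the other law
`F (1 - j)`, so that the signal is false. (All such `P` agree on the observations.) -/
noncomputable def runLength (F : Fin 2 → Measure 𝒳) (X : ℕ → Ω → 𝒳) (𝓜 : Set (Measure Ω))
    (Z : ℕ → Ω → Set (Fin 2)) (j : Fin 2) : ℝ≥0∞ :=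
  ⨅ (n : ℕ) (_ : 1 ≤ n) (P ∈ 𝓜) (_ : ∀ t, 1 ≤ t → P.map (X t) = F (1 - j)),
    worstMeanDelay X P Z j n

/-- `Z`, from the class `𝒵`, satisfies `B^0 ≥ c₀` and `B^1 ≥ c₁`. -/
def IsFeasible (F : Fin 2 → Measure 𝒳) (X : ℕ → Ω → 𝒳) (𝓜 : Set (Measure Ω)) (c₀ c₁ : ℝ)
    (𝒵 : Set (ℕ → Ω → Set (Fin 2))) (Z : ℕ → Ω → Set (Fin 2)) : Prop :=
  Z ∈ 𝒵 ∧ ENNReal.ofReal c₀ ≤ runLength F X 𝓜 Z 0 ∧ ENNReal.ofReal c₁ ≤ runLength F X 𝓜 Z 1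

/-- `Z` is feasible and minimises both `C^1` and `C^0` among the feasible processes of `𝒵`. -/
def IsSolution (F : Fin 2 → Measure 𝒳) (X : ℕ → Ω → 𝒳) (𝓜 : Set (Measure Ω)) (c₀ c₁ : ℝ)
    (𝒵 : Set (ℕ → Ω → Set (Fin 2))) (Z : ℕ → Ω → Set (Fin 2)) : Prop :=
  IsFeasible F X 𝓜 c₀ c₁ 𝒵 Z ∧
    ∀ Z', IsFeasible F X 𝓜 c₀ c₁ 𝒵 Z' →
      worstDelay F X 𝓜 Z 1 ≤ worstDelay F X 𝓜 Z' 1 ∧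
      worstDelay F X 𝓜 Z 0 ≤ worstDelay F X 𝓜 Z' 0

/-- Non-restarting CUSUM chart with holding barriers `0` and `h`, started at `r`;
`llr (F 1) (F 0)` is the logarithm of the density of `F 1` with respect to `F 0`. -/
noncomputable def chart (F : Fin 2 → Measure 𝒳) (X : ℕ → Ω → 𝒳) (h r : ℝ) : ℕ → Ω → ℝ
  | 0, _ => r
  | t + 1, ω => min (max (chart F X h r t ω + llr (F 1) (F 0) (X (t + 1) ω)) 0) h

/-- Signal `0` when the upper chart is at most `h - kU`; signal `1` when the lower chart is at
least `kL`. -/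
def twoChartSignal (F : Fin 2 → Measure 𝒳) (X : ℕ → Ω → 𝒳) (kU kL h : ℝ) (t : ℕ) (ω : Ω) :
    Set (Fin 2) :=
  {j | (j = 0 ∧ chart F X h h t ω ≤ h - kU) ∨ (j = 1 ∧ kL ≤ chart F X h 0 t ω)}

open Classical in
/-- The single-valued version, by cases in this order. -/
noncomputable def twoChartSingleSignal (F : Fin 2 → Measure 𝒳) (X : ℕ → Ω → 𝒳) (kU kL h : ℝ)
    (t : ℕ) (ω : Ω) : Set (Fin 2) :=
  if chart F X h h t ω ≤ h - kU then {0}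
  else if kL ≤ chart F X h 0 t ω then {1}
  else ∅

end SignalDetection

/-! `C^j` and `B^j` only see the times at which `j` is signalled, so the problem splits into two
one-signal problems. Reflecting the chart about `h/2` and changing the sign of the score exchanges
them, so one result, `exists_optimal_threshold`, serves for both signals. That result is the
optimality of CUSUM for Lorden's criterion.

Upper bound. For a threshold `k ≤ h` the cap at `h` is invisible until the signal. The conditional
mean delay is therefore `meanExit` at the current chart value (`IsObservationLaw.condLExp_delay`),
and it is largest at value `0`. This bounds `C^j` by `meanExit` from `0` under `F j`. For the run
length, the chart is at `0` with positive probability at every time, so the essential supremum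
attains `meanExit` from `0` under `F (1 - j)`. Without atoms `meanExit` from `0` is continuous in
`k`, so `k` can be tuned to the constraint exactly (`exists_threshold_meanExit_eq`).

Lower bound (`meanExit_le_worstDelay`). The exponential of the uncapped CUSUM chart is a mixture,
over change times, of likelihood ratios. Averaging Lorden's bound over this mixture
(`sum_lintegral_exp_cusum_le`) reduces the matter to a stopping problem for the chart under the law
without change. Its Lagrangian dual is solved by `exists_supersolution`. The certificate there has
the right sign because a Poisson equation with nondecreasing cost has a solution that changes sign
only at `k` (`nonpos_and_nonneg_of_poisson`, by coupling two charts).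

Single-valued case. Since `R^L ≤ R^U`, a conflict when `h ≤ kU + kL` forces `R^L = kL`, which is
either null or impossible. The case distinction thus changes nothing almost surely, and the lower
bound already holds in the larger class. -/

namespace SignalDetection

open Set Filter Topology

/-! ### The reflected CUSUM step. -/

section CusumStep

variable {𝒳 : Type*}

/-- One step of the CUSUM recursion with score `g`, reflected at `0`. -/
def cusumStep (g : 𝒳 → ℝ) (r : ℝ) (x : 𝒳) : ℝ := max (r + g x) 0

lemma cusumStep_nonneg (g : 𝒳 → ℝ) (r : ℝ) (x : 𝒳) : 0 ≤ cusumStep g r x := le_max_right _ _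

lemma cusumStep_mono (g : 𝒳 → ℝ) (x : 𝒳) : Monotone fun r => cusumStep g r x :=
  fun _ _ h => max_le_max_right _ (by linarith)

variable [MeasurableSpace 𝒳]

lemma measurable_cusumStep_uncurry {g : 𝒳 → ℝ} (hg : Measurable g) :
    Measurable fun p : ℝ × 𝒳 => cusumStep g p.1 p.2 :=
  (measurable_fst.add (hg.comp measurable_snd)).max measurable_const

lemma measurable_cusumStep {g : 𝒳 → ℝ} (hg : Measurable g) (r : ℝ) :
    Measurable (cusumStep g r) :=
  (measurable_cusumStep_uncurry hg).comp measurable_prodMk_left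

lemma measurable_indicator_cusumStep {g : 𝒳 → ℝ} (hg : Measurable g) {f : ℝ → ℝ≥0∞}
    (hf : Measurable f) (k r : ℝ) :
    Measurable fun x => (Iio k).indicator f (cusumStep g r x) :=
  (hf.indicator measurableSet_Iio).comp (measurable_cusumStep hg r)

end CusumStep

lemma indicator_Iio_antitone {f : ℝ → ℝ≥0∞} (hf : Antitone f) (k : ℝ) :
    Antitone ((Iio k).indicator f) := by
  intro a b hab
  by_cases hb : b < k
  · have ha : a < k := hab.trans_lt hb
    simpa [indicator, ha, hb] using hf hab
  · simp [indicator, hb]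

/-! ### Mean exit times of the CUSUM chart and the choice of the threshold. -/

section Survival

variable {𝒳 : Type*} [MeasurableSpace 𝒳]

/-- The probability that a CUSUM chart with i.i.d. inputs of law `μ`, started at `r`, stays below
`k` during the steps `1, …, n`. -/
noncomputable def surv (μ : Measure 𝒳) (g : 𝒳 → ℝ) (k : ℝ) : ℕ → ℝ → ℝ≥0∞
  | 0, _ => 1
  | n + 1, r => ∫⁻ x, (Iio k).indicator (surv μ g k n) (cusumStep g r x) ∂μ

/-- The mean number of steps until the CUSUM chart started at `r` reaches `k`. -/
noncomputable def meanExit (μ : Measure 𝒳) (g : 𝒳 → ℝ) (k r : ℝ) : ℝ≥0∞ := ∑' n, surv μ g k n r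

variable {μ : Measure 𝒳} {g : 𝒳 → ℝ} {k : ℝ}

lemma measurable_surv [SFinite μ] (hg : Measurable g) (n : ℕ) : Measurable (surv μ g k n) := by
  induction n with
  | zero => exact measurable_const
  | succ n ih =>
    exact Measurable.lintegral_prod_right'
      (f := fun p : ℝ × 𝒳 => (Iio k).indicator (surv μ g k n) (cusumStep g p.1 p.2))
      ((ih.indicator measurableSet_Iio).comp (measurable_cusumStep_uncurry hg))

lemma measurable_meanExit [SFinite μ] (hg : Measurable g) : Measurable (meanExit μ g k) :=
  Measurable.tsum (measurable_surv hg)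

lemma surv_antitone (n : ℕ) : Antitone (surv μ g k n) := by
  induction n with
  | zero => exact fun _ _ _ => le_rfl
  | succ n ih =>
    exact fun a b hab => lintegral_mono fun x =>
      indicator_Iio_antitone ih k (cusumStep_mono g x hab)

lemma meanExit_antitone : Antitone (meanExit μ g k) :=
  fun _ _ hab => ENNReal.tsum_le_tsum fun n => surv_antitone n hab

lemma surv_le_one [IsProbabilityMeasure μ] (n : ℕ) (r : ℝ) : surv μ g k n r ≤ 1 := by
  induction n generalizing r with
  | zero => exact le_rfl
  | succ n ih =>
    calc surv μ g k (n + 1) r ≤ ∫⁻ _, 1 ∂μ :=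
          lintegral_mono fun x => indicator_apply_le' (fun _ => ih _) fun _ => zero_le
      _ = 1 := by simp

lemma surv_mono_threshold {k' : ℝ} (hk : k ≤ k') (n : ℕ) (r : ℝ) :
    surv μ g k n r ≤ surv μ g k' n r := by
  induction n generalizing r with
  | zero => exact le_rfl
  | succ n ih =>
    refine lintegral_mono fun x => ?_
    refine (indicator_le_indicator (ih _)).trans ?_
    exact indicator_le_indicator_of_subset (Iio_subset_Iio hk) (fun _ => zero_le) _

lemma meanExit_eq_one_add [SFinite μ] (hg : Measurable g) (r : ℝ) :
    meanExit μ g k r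
      = 1 + ∫⁻ x, (Iio k).indicator (meanExit μ g k) (cusumStep g r x) ∂μ := by
  have h : ∀ y, (Iio k).indicator (meanExit μ g k) y
      = ∑' n, (Iio k).indicator (surv μ g k n) y := by
    intro y
    by_cases hy : y < k <;> simp [indicator, hy, meanExit]
  simp_rw [h]
  rw [lintegral_tsum fun n =>
    (measurable_indicator_cusumStep hg (measurable_surv hg n) k r).aemeasurable]
  rw [meanExit, tsum_eq_zero_add' ENNReal.summable]
  rfl

lemma one_le_meanExit [SFinite μ] (hg : Measurable g) (r : ℝ) : 1 ≤ meanExit μ g k r := by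
  rw [meanExit_eq_one_add hg]
  exact le_self_add

/-- Exponential Lyapunov bound for the truncated mean exit time. -/
lemma sum_surv_add_exp_le [IsProbabilityMeasure μ] (hg : Measurable g) {δ θ : ℝ} (hδ : 0 ≤ δ)
    (hθ : 0 ≤ θ)
    (h : 2 ≤ μ {x | δ ≤ g x} * ENNReal.ofReal (Real.exp (θ * δ))) (N : ℕ) (r : ℝ) (hr : 0 ≤ r)
    (hrk : r < k) :
    ∑ n ∈ Finset.range N, surv μ g k n r + ENNReal.ofReal (Real.exp (θ * r))
      ≤ ENNReal.ofReal (Real.exp (θ * (k + δ))) := by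
  induction N generalizing r with
  | zero =>
    simp only [Finset.range_zero, Finset.sum_empty, zero_add]
    gcongr
    linarith
  | succ N ih =>
    -- The factor `2` in `h` pays for the elapsed step: an upward jump of at least `δ` alone
    -- multiplies `exp (θ r) ≥ 1` by `2` on average.
    have hexp : 1 + ENNReal.ofReal (Real.exp (θ * r))
        ≤ μ {x | δ ≤ g x} * ENNReal.ofReal (Real.exp (θ * (r + δ))) := by
      have h1 : (1 : ℝ≥0∞) ≤ ENNReal.ofReal (Real.exp (θ * r)) := by
        rw [← ENNReal.ofReal_one]
        exact ENNReal.ofReal_le_ofReal (Real.one_le_exp (by positivity))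
      calc 1 + ENNReal.ofReal (Real.exp (θ * r))
          ≤ 2 * ENNReal.ofReal (Real.exp (θ * r)) := by
            rw [two_mul]; gcongr
        _ ≤ (μ {x | δ ≤ g x} * ENNReal.ofReal (Real.exp (θ * δ)))
              * ENNReal.ofReal (Real.exp (θ * r)) := by gcongr
        _ = _ := by
            rw [mul_assoc, ← ENNReal.ofReal_mul (Real.exp_pos _).le, ← Real.exp_add]
            congr 4; ring
    have hsum : ∑ n ∈ Finset.range N, surv μ g k (n + 1) r
        = ∫⁻ x, ∑ n ∈ Finset.range N, (Iio k).indicator (surv μ g k n) (cusumStep g r x) ∂μ :=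
      (lintegral_finsetSum _ fun n _ =>
        measurable_indicator_cusumStep hg (measurable_surv hg n) _ r).symm
    have hset : MeasurableSet {x | δ ≤ g x} := measurableSet_le measurable_const hg
    rw [Finset.sum_range_succ', hsum]
    change (_ + 1 + _ ≤ _)
    rw [add_assoc]
    refine (add_le_add_right hexp _).trans ?_
    rw [mul_comm (μ _), ← lintegral_indicator_const hset, ← lintegral_add_left]
    swap
    · exact Finset.measurable_sum _ fun n _ =>
        measurable_indicator_cusumStep hg (measurable_surv hg n) _ r
    calc _ ≤ ∫⁻ _, ENNReal.ofReal (Real.exp (θ * (k + δ))) ∂μ := ?_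
      _ = _ := by simp
    refine lintegral_mono fun x => ?_
    by_cases hx : cusumStep g r x < k
    · refine le_trans ?_ (ih (cusumStep g r x) (cusumStep_nonneg _ _ _) hx)
      gcongr with n hn
      · exact indicator_le_self _ _ _
      · by_cases hd : δ ≤ g x
        · simp only [indicator, mem_ofPred_eq, hd, if_true]
          gcongr
          exact le_max_of_le_left (by linarith)
        · simp [indicator, hd]
    -- On exit no time remains, and only a jump of `δ` from `r < k` was credited; hence the bound
    -- with `k + δ`, whatever the overshoot.
    · have : ∀ n ∈ Finset.range N, (Iio k).indicator (surv μ g k n) (cusumStep g r x) = 0 :=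
        fun n _ => indicator_of_notMem (by simpa using hx) _
      rw [Finset.sum_eq_zero this, zero_add]
      refine (indicator_le_self _ _ _).trans ?_
      gcongr

lemma exists_pos_measure_le [IsProbabilityMeasure μ] {c : ℝ≥0∞} (h : c < μ {x | 0 < g x}) :
    ∃ δ > 0, c < μ {x | δ ≤ g x} := by
  have hu : {x | 0 < g x} = ⋃ n : ℕ, {x | 1 / ((n : ℝ) + 1) ≤ g x} := by
    ext x
    simp only [mem_ofPred_eq, mem_iUnion]
    refine ⟨fun hx => ?_, fun ⟨n, hn⟩ => lt_of_lt_of_le Nat.one_div_pos_of_nat hn⟩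
    obtain ⟨n, hn⟩ := exists_nat_one_div_lt hx
    exact ⟨n, hn.le⟩
  have hm : Monotone fun n : ℕ => {x | 1 / ((n : ℝ) + 1) ≤ g x} :=
    fun a b hab x hx => le_trans (α := ℝ) (Nat.one_div_le_one_div hab) hx
  have := tendsto_measure_iUnion_atTop (μ := μ) hm
  rw [← hu] at this
  obtain ⟨n, hn⟩ := (this.eventually (lt_mem_nhds h)).exists
  exact ⟨_, Nat.one_div_pos_of_nat, hn⟩

lemma meanExit_lt_top [IsProbabilityMeasure μ] (hg : Measurable g) (hpos : 0 < μ {x | 0 < g x})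
    (hk : 0 < k) {r : ℝ} (hr : 0 ≤ r) : meanExit μ g k r < ∞ := by
  refine (meanExit_antitone hr).trans_lt ?_
  obtain ⟨δ, hδ, hp⟩ := exists_pos_measure_le hpos
  set p := (μ {x | δ ≤ g x}).toReal with hpdef
  have hp' : 0 < p := ENNReal.toReal_pos hp.ne' (measure_ne_top _ _)
  -- From `1 + x ≤ exp x` with `x = 2 / p`.
  obtain ⟨θ, hθ, h2⟩ : ∃ θ : ℝ, 0 ≤ θ ∧ 2 / p ≤ Real.exp (θ * δ) := by
    refine ⟨(2 / p) / δ, by positivity, ?_⟩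
    rw [div_mul_cancel₀ _ hδ.ne']
    linarith [Real.add_one_le_exp (2 / p)]
  have h2' : 2 ≤ μ {x | δ ≤ g x} * ENNReal.ofReal (Real.exp (θ * δ)) := by
    rw [← ENNReal.ofReal_toReal (measure_ne_top μ {x | δ ≤ g x}), ← hpdef,
      ← ENNReal.ofReal_mul hp'.le, ← ENNReal.ofReal_ofNat]
    refine ENNReal.ofReal_le_ofReal ?_
    rw [div_le_iff₀ hp'] at h2
    linarith
  have : meanExit μ g k 0 ≤ ENNReal.ofReal (Real.exp (θ * (k + δ))) := by
    rw [meanExit, ENNReal.tsum_eq_iSup_nat]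
    exact iSup_le fun N =>
      le_self_add.trans (sum_surv_add_exp_le hg hδ.le hθ h2' N 0 le_rfl hk)
  exact this.trans_lt ENNReal.ofReal_lt_top

/-- The chart is nonnegative, so a single input with `g ≥ k` carries it past `k` from anywhere. -/
lemma surv_le_pow [IsProbabilityMeasure μ] (hg : Measurable g) (n : ℕ) {r : ℝ} (hr : 0 ≤ r) :
    surv μ g k n r ≤ μ {x | g x < k} ^ n := by
  induction n generalizing r with
  | zero => exact le_of_eq (pow_zero _).symm
  | succ n ih =>
    have hset : MeasurableSet {x | g x < k} := measurableSet_lt hg measurable_const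
    calc surv μ g k (n + 1) r ≤ ∫⁻ x, {x | g x < k}.indicator (fun _ => μ {x | g x < k} ^ n) x ∂μ
          := by
          refine lintegral_mono fun x => ?_
          by_cases hx : cusumStep g r x < k
          · have : g x < k := lt_of_le_of_lt (le_max_of_le_left (by linarith)) hx
            simpa [indicator, hx, this] using ih (cusumStep_nonneg g r x)
          · simp [indicator, hx]
      _ = _ := by rw [lintegral_indicator_const hset, pow_succ]

lemma meanExit_mul_le_one [IsProbabilityMeasure μ] (hg : Measurable g) {r : ℝ} (hr : 0 ≤ r)  :
    meanExit μ g k r * μ {x | k ≤ g x} ≤ 1 := by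
  have h : meanExit μ g k r ≤ (1 - μ {x | g x < k})⁻¹ := by
    rw [← ENNReal.tsum_geometric]
    exact ENNReal.tsum_le_tsum fun n => surv_le_pow hg n hr
  have hc : μ {x | k ≤ g x} = 1 - μ {x | g x < k} := by
    rw [← prob_compl_eq_one_sub (measurableSet_lt hg measurable_const)]
    congr 1; ext x; simp
  rw [hc]
  exact (mul_le_mul_left h _).trans (ENNReal.inv_mul_le_one _)

lemma continuousAt_indicator_Iio {f : ℝ → ℝ≥0∞} {y k : ℝ} (hy : y ≠ k) (hf : ContinuousAt f k) :
    ContinuousAt (fun k' => (Iio k').indicator (fun _ => f k') y) k := by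
  rcases lt_or_gt_of_ne hy with h | h
  · refine hf.congr ?_
    filter_upwards [lt_mem_nhds h] with k' hk'
    simp [indicator, hk']
  · refine (continuousAt_const (y := (0 : ℝ≥0∞))).congr ?_
    filter_upwards [gt_mem_nhds h] with k' hk'
    simp [indicator, not_lt.2 hk'.le]

/-- Continuity fails only if the chart lands exactly on `k`. As `k > 0`, this needs `g x = k - r`, a
null event; the barrier `0` is out of reach of `k`. -/
lemma continuousAt_surv_threshold [IsProbabilityMeasure μ] (hg : Measurable g)
    (hatom : ∀ a, μ {x | g x = a} = 0) (hk : 0 < k) (n : ℕ) (r : ℝ) :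
    ContinuousAt (fun k' => surv μ g k' n r) k := by
  induction n generalizing r with
  | zero => exact continuousAt_const
  | succ n ih =>
    refine tendsto_lintegral_filter_of_dominated_convergence (fun _ => 1) ?_ ?_ (by simp) ?_
    · exact Eventually.of_forall fun k' =>
        measurable_indicator_cusumStep hg (measurable_surv hg n) _ r
    · exact Eventually.of_forall fun k' => Eventually.of_forall fun x =>
        indicator_apply_le' (fun _ => surv_le_one _ _) fun _ => zero_le
    · have hne : ∀ᵐ x ∂μ, g x ≠ k - r := by
        rw [ae_iff]; simpa using hatom (k - r)
      filter_upwards [hne] with x hx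
      have hy : cusumStep g r x ≠ k := by
        intro h
        unfold cusumStep at h
        rcases max_choice (r + g x) 0 with h' | h' <;> rw [h'] at h
        · exact hx (by linarith)
        · exact hk.ne h
      exact continuousAt_indicator_Iio hy (ih (cusumStep g r x))

lemma tendsto_surv_threshold_atTop [IsProbabilityMeasure μ] (hg : Measurable g) (n : ℕ) (r : ℝ) :
    Tendsto (fun k' => surv μ g k' n r) atTop (𝓝 1) := by
  induction n generalizing r with
  | zero => exact tendsto_const_nhds
  | succ n ih =>
    have h1 : (1 : ℝ≥0∞) = ∫⁻ _, 1 ∂μ := by simp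
    rw [h1]
    refine tendsto_lintegral_filter_of_dominated_convergence (fun _ => 1) ?_ ?_ (by simp) ?_
    · exact Eventually.of_forall fun k' =>
        measurable_indicator_cusumStep hg (measurable_surv hg n) _ r
    · exact Eventually.of_forall fun k' => Eventually.of_forall fun x =>
        indicator_apply_le' (fun _ => surv_le_one _ _) fun _ => zero_le
    · refine Eventually.of_forall fun x => (ih (cusumStep g r x)).congr' ?_
      filter_upwards [eventually_gt_atTop (cusumStep g r x)] with k' hk'
      simp [indicator, hk']

/-- Survival is monotone in the threshold, so the summable sequence at `b` dominates the series on
all of `[a, b]`. -/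
lemma continuousOn_meanExit_threshold [IsProbabilityMeasure μ] (hg : Measurable g)
    (hatom : ∀ a, μ {x | g x = a} = 0) (hpos : 0 < μ {x | 0 < g x}) (a b : ℝ) (ha : 0 < a)
    (hab : a ≤ b) :
    ContinuousOn (fun k' => (meanExit μ g k' 0).toReal) (Icc a b) := by
  have hfin : ∑' n, surv μ g b n 0 ≠ ∞ := (meanExit_lt_top hg hpos (ha.trans_le hab) le_rfl).ne
  have heq : ∀ k', (meanExit μ g k' 0).toReal = ∑' n, (surv μ g k' n 0).toReal := fun k' =>
    ENNReal.tsum_toReal_eq fun n => ((surv_le_one n 0).trans_lt ENNReal.one_lt_top).ne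
  simp_rw [heq]
  refine continuousOn_tsum (u := fun n => (surv μ g b n 0).toReal) ?_
    (ENNReal.summable_toReal hfin) ?_
  · intro n k' hk'
    refine ContinuousAt.continuousWithinAt ?_
    exact (ENNReal.continuousAt_toReal ((surv_le_one n 0).trans_lt ENNReal.one_lt_top).ne).comp
      (f := fun k' => surv μ g k' n 0)
      (continuousAt_surv_threshold hg hatom (ha.trans_le hk'.1) n 0)
  · intro n k' hk'
    rw [Real.norm_of_nonneg ENNReal.toReal_nonneg]
    exact ENNReal.toReal_mono ((surv_le_one n 0).trans_lt ENNReal.one_lt_top).ne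
      (surv_mono_threshold hk'.2 n 0)

/-- Any mean run length above `1 / μ {g > 0}` is that of some threshold. -/
theorem exists_threshold_meanExit_eq [IsProbabilityMeasure μ] (hg : Measurable g)
    (hatom : ∀ a, μ {x | g x = a} = 0) {c : ℝ} (hc : 1 < ENNReal.ofReal c * μ {x | 0 < g x}) :
    ∃ k > 0, meanExit μ g k 0 = ENNReal.ofReal c := by
  have hc0 : ENNReal.ofReal c ≠ 0 := by rintro h; simp [h] at hc
  have hpos : 0 < μ {x | 0 < g x} := by
    refine pos_iff_ne_zero.2 ?_
    rintro h; simp [h] at hc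
  have hc' : (ENNReal.ofReal c)⁻¹ < μ {x | 0 < g x} := by
    rw [ENNReal.inv_lt_iff_inv_lt]
    rw [← ENNReal.div_eq_inv_mul.trans (mul_one _), ENNReal.div_lt_iff (Or.inl hpos.ne')
      (Or.inl (measure_ne_top _ _))]
    exact hc
  -- A threshold `a` so low that one input exceeds it with probability above `1 / c`: the mean exit
  -- time is then at most `c`.
  obtain ⟨a, ha, hac⟩ := exists_pos_measure_le hc'
  have hlow : meanExit μ g a 0 ≤ ENNReal.ofReal c := by
    have h1 := meanExit_mul_le_one (μ := μ) (k := a) hg le_rfl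
    have hne : μ {x | a ≤ g x} ≠ 0 := (zero_le.trans_lt hac).ne'
    calc meanExit μ g a 0 ≤ (μ {x | a ≤ g x})⁻¹ := by
          rw [ENNReal.le_inv_iff_mul_le]; exact h1
      _ ≤ _ := by
          rw [ENNReal.inv_le_iff_inv_le]; exact hac.le
  -- A high threshold makes each of the first `N` survival probabilities close to `1`, so their sum
  -- exceeds `c`.
  obtain ⟨N, hN⟩ := exists_nat_gt (c + 1)
  obtain ⟨b, hab, hbc⟩ : ∃ b, a ≤ b ∧ ENNReal.ofReal c ≤ meanExit μ g b 0 := by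
    have hlim : Tendsto (fun k' => ∑ n ∈ Finset.range N, surv μ g k' n 0) atTop
        (𝓝 (∑ n ∈ Finset.range N, 1)) :=
      tendsto_finsetSum _ fun n _ => tendsto_surv_threshold_atTop hg n 0
    have hlt : ENNReal.ofReal c < ∑ n ∈ Finset.range N, (1 : ℝ≥0∞) := by
      simp only [Finset.sum_const, Finset.card_range, nsmul_eq_mul, mul_one]
      rw [← ENNReal.ofReal_natCast]
      have : 0 < c := by
        by_contra h
        exact hc0 (ENNReal.ofReal_eq_zero.2 (not_lt.1 h))
      exact (ENNReal.ofReal_lt_ofReal_iff (by linarith)).2 (by linarith)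
    obtain ⟨b, hb1, hb2⟩ :=
      ((hlim.eventually (lt_mem_nhds hlt)).and (eventually_ge_atTop a)).exists
    exact ⟨b, hb2, hb1.le.trans (ENNReal.sum_le_tsum _)⟩
  have hbpos : 0 < b := ha.trans_le hab
  have hfin : ∀ k', 0 < k' → meanExit μ g k' 0 ≠ ∞ := fun k' hk' =>
    (meanExit_lt_top hg hpos hk' le_rfl).ne
  have hivt := intermediate_value_Icc hab (continuousOn_meanExit_threshold hg hatom hpos a b ha hab)
  have hmem : (ENNReal.ofReal c).toReal ∈
      Icc (meanExit μ g a 0).toReal (meanExit μ g b 0).toReal :=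
    ⟨ENNReal.toReal_mono ENNReal.ofReal_ne_top hlow, ENNReal.toReal_mono (hfin b hbpos) hbc⟩
  obtain ⟨k, hk, hkc⟩ := hivt hmem
  refine ⟨k, ha.trans_le hk.1, ?_⟩
  exact (ENNReal.toReal_eq_toReal_iff' (hfin k (ha.trans_le hk.1)) ENNReal.ofReal_ne_top).1 hkc

end Survival
-- Sign of solutions of the Poisson equation for the killed chart.
section ThresholdOptimality

variable {𝒳 : Type*} [MeasurableSpace 𝒳] {μ : Measure 𝒳} [IsProbabilityMeasure μ]
  {g : 𝒳 → ℝ} {k : ℝ}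

lemma integrable_indicator_cusumStep (hg : Measurable g) {f : ℝ → ℝ} (hf : Measurable f) {B : ℝ}
    (hB : ∀ r, 0 ≤ r → r < k → |f r| ≤ B) (hB0 : 0 ≤ B) (r : ℝ) :
    Integrable (fun x => (Iio k).indicator f (cusumStep g r x)) μ := by
  refine Integrable.of_bound (C := B)
    ((hf.indicator measurableSet_Iio).comp (measurable_cusumStep hg r)).aestronglyMeasurable ?_
  refine Eventually.of_forall fun x => ?_
  by_cases hx : cusumStep g r x < k
  · simpa [indicator, hx] using hB _ (cusumStep_nonneg g r x) hx
  · simpa [indicator, hx] using hB0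

lemma integrable_ite_sub (hg : Measurable g) {G : ℝ → ℝ} (hG : Measurable G) {B s : ℝ}
    (hB : ∀ r, 0 ≤ r → r < k → |G r| ≤ B) (hB0 : 0 ≤ B) (hs0 : 0 ≤ s) {r₁ r₂ : ℝ}
    (h12 : r₁ ≤ r₂) :
    Integrable (fun x => if cusumStep g r₂ x < k then
      G (cusumStep g r₁ x) - G (cusumStep g r₂ x) - s else 0) μ := by
  refine Integrable.of_bound (C := B + B + s) ?_ (Eventually.of_forall fun x => ?_)
  · refine (Measurable.ite (measurableSet_lt (measurable_cusumStep hg r₂) measurable_const)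
      ?_ measurable_const).aestronglyMeasurable
    exact ((hG.comp (measurable_cusumStep hg r₁)).sub
      (hG.comp (measurable_cusumStep hg r₂))).sub measurable_const
  · split_ifs with hx
    · have h1 := abs_le.1 (hB _ (cusumStep_nonneg g r₁ x) ((cusumStep_mono g x h12).trans_lt hx))
      have h2 := abs_le.1 (hB _ (cusumStep_nonneg g r₂ x) hx)
      rw [Real.norm_eq_abs, abs_le]
      constructor <;> linarith
    · simp only [norm_zero]; positivity

/-- The increments of a solution of a Poisson equation for the chart killed at `k`, with
nondecreasing cost, are subsolutions along a pair of charts driven by the same inputs. -/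
lemma sub_sub_le_integral (hg : Measurable g) {G q : ℝ → ℝ} (hG : Measurable G) {B s : ℝ}
    (hB : ∀ r, 0 ≤ r → r < k → |G r| ≤ B) (hB0 : 0 ≤ B) (hq : MonotoneOn q (Ici 0))
    (hGq : ∀ r, 0 ≤ r → G r = q r + ∫ x, (Iio k).indicator G (cusumStep g r x) ∂μ)
    (hs0 : 0 ≤ s) (hs : ∀ r, 0 ≤ r → r < k → G r ≤ s) {r₁ r₂ : ℝ} (h0 : 0 ≤ r₁) (h12 : r₁ ≤ r₂) :
    G r₁ - G r₂ - s ≤ ∫ x, (if cusumStep g r₂ x < k then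
      G (cusumStep g r₁ x) - G (cusumStep g r₂ x) - s else 0) ∂μ := by
  have hi1 := integrable_indicator_cusumStep (μ := μ) hg hG hB hB0 r₁
  have hi2 := integrable_indicator_cusumStep (μ := μ) hg hG hB hB0 r₂
  have hi12 : Integrable (fun x => (Iio k).indicator G (cusumStep g r₁ x)
    - (Iio k).indicator G (cusumStep g r₂ x)) μ := hi1.sub hi2
  have hm := hq h0 (h0.trans h12) h12
  have hle : ∫ x, ((Iio k).indicator G (cusumStep g r₁ x) - (Iio k).indicator G (cusumStep g r₂ x)
      - s) ∂μ ≤ ∫ x, (if cusumStep g r₂ x < k then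
      G (cusumStep g r₁ x) - G (cusumStep g r₂ x) - s else 0) ∂μ := by
    refine integral_mono (hi12.sub (integrable_const s)) ?_ fun x => ?_
    · exact integrable_ite_sub hg hG hB hB0 hs0 h12
    -- The higher chart exits no later than the lower one. If it exits alone, what is left is `G` at
    -- the lower chart, at most `s`; if both exit, `0 ≤ s`.
    · by_cases h2 : cusumStep g r₂ x < k
      · have h1 : cusumStep g r₁ x < k := (cusumStep_mono g x h12).trans_lt h2
        simp [indicator, h1, h2]
      · by_cases h1 : cusumStep g r₁ x < k
        · simpa [indicator, h1, h2] using hs _ (cusumStep_nonneg g r₁ x) h1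
        · simpa [indicator, h1, h2] using hs0
  rw [integral_sub hi12 (integrable_const s), integral_sub hi1 hi2] at hle
  simp only [integral_const, probReal_univ, one_smul] at hle
  rw [hGq r₁ h0, hGq r₂ (h0.trans h12)]
  linarith

/-- With the mean exit time `E` as a weight, the killed chart contracts, so that bounded
subsolutions for a pair of charts are nonpositive. -/
lemma nonpos_of_le_integral (hg : Measurable g) {E : ℝ → ℝ} (hE : Measurable E) {E₀ C : ℝ}
    (hE1 : ∀ r, 0 ≤ r → 1 ≤ E r) (hE0 : ∀ r, 0 ≤ r → E r ≤ E₀)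
    (hEeq : ∀ r, 0 ≤ r → E r = 1 + ∫ x, (Iio k).indicator E (cusumStep g r x) ∂μ)
    {N : ℝ → ℝ → ℝ} (hC0 : 0 ≤ C) (hNC : ∀ r₁ r₂, 0 ≤ r₁ → r₁ ≤ r₂ → r₂ < k → N r₁ r₂ ≤ C)
    (hN : ∀ r₁ r₂, 0 ≤ r₁ → r₁ ≤ r₂ → N r₁ r₂ ≤ ∫ x, (if cusumStep g r₂ x < k then
      N (cusumStep g r₁ x) (cusumStep g r₂ x) else 0) ∂μ)
    {r₁ r₂ : ℝ} (h0 : 0 ≤ r₁) (h12 : r₁ ≤ r₂) : N r₁ r₂ ≤ 0 := by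
  have hE₀ : 1 ≤ E₀ := (hE1 0 le_rfl).trans (hE0 0 le_rfl)
  have hiE : ∀ r, Integrable (fun x => (Iio k).indicator E (cusumStep g r x)) μ := fun r =>
    integrable_indicator_cusumStep hg hE (B := E₀) (fun r hr _ => by
      rw [abs_of_nonneg (zero_le_one.trans (hE1 r hr))]; exact hE0 r hr) (by linarith) r
  -- One killed step turns `E` into `E - 1`, and `E ≤ E₀` gives `E - 1 ≤ θ E`.
  set θ := 1 - 1 / E₀ with hθ
  have hθ0 : 0 ≤ θ := by
    rw [hθ, sub_nonneg, div_le_one (by linarith)]; exact hE₀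
  have hθ1 : θ < 1 := by
    have : 0 < 1 / E₀ := by positivity
    linarith
  have key : ∀ D : ℝ, 0 ≤ D → (∀ a b, 0 ≤ a → a ≤ b → b < k → N a b ≤ D * E b) →
      ∀ a b, 0 ≤ a → a ≤ b → N a b ≤ D * θ * E b := by
    intro D hD h a b ha hab
    have h1 : ∫ x, (if cusumStep g b x < k then
        N (cusumStep g a x) (cusumStep g b x) else 0) ∂μ
        ≤ ∫ x, D * (Iio k).indicator E (cusumStep g b x) ∂μ := by
      by_cases hint : Integrable (fun x => if cusumStep g b x < k then
        N (cusumStep g a x) (cusumStep g b x) else 0) μ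
      · refine integral_mono hint ((hiE b).const_mul D) fun x => ?_
        by_cases hx : cusumStep g b x < k
        · simpa [indicator, hx] using
            h _ _ (cusumStep_nonneg g a x) (cusumStep_mono g x hab) hx
        · simp [indicator, hx]
      -- Without integrability the Bochner integral is `0`, below the nonnegative right-hand side.
      · rw [integral_undef hint]
        refine integral_nonneg fun x => mul_nonneg hD ?_
        exact indicator_apply_nonneg fun _ => zero_le_one.trans (hE1 _ (cusumStep_nonneg g b x))
    have hb := hEeq b (ha.trans hab)
    rw [integral_const_mul] at h1
    have h2 : E b - 1 ≤ θ * E b := by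
      have : E b / E₀ ≤ 1 := by
        rw [div_le_one (by linarith)]; exact hE0 b (ha.trans hab)
      rw [hθ]; ring_nf; ring_nf at this; linarith
    calc N a b ≤ D * (E b - 1) := by
          rw [hb]; refine (hN a b ha hab).trans (h1.trans (le_of_eq ?_)); ring
      _ ≤ D * (θ * E b) := by gcongr
      _ = _ := by ring
  have hall : ∀ n : ℕ, ∀ a b, 0 ≤ a → a ≤ b → b < k → N a b ≤ C * θ ^ n * E b := by
    intro n
    induction n with
    | zero =>
      intro a b ha hab hb
      have := hE1 b (ha.trans hab)
      calc N a b ≤ C * 1 := by rw [mul_one]; exact hNC a b ha hab hb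
        _ ≤ C * θ ^ 0 * E b := by simpa using mul_le_mul_of_nonneg_left this hC0
    | succ n ih =>
      intro a b ha hab _
      rw [pow_succ, ← mul_assoc]
      exact key _ (by positivity) ih a b ha hab
  have hall' : ∀ n : ℕ, N r₁ r₂ ≤ C * θ ^ n * θ * E r₂ := fun n =>
    key _ (by positivity) (hall n) r₁ r₂ h0 h12
  have hlim : Tendsto (fun n : ℕ => C * θ ^ n * θ * E r₂) atTop (𝓝 (C * 0 * θ * E r₂)) :=
    (((tendsto_pow_atTop_nhds_zero_of_lt_one hθ0 hθ1).const_mul C).mul_const θ).mul_const _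
  simpa using ge_of_tendsto' hlim hall'

/-- A solution of the Poisson equation for the chart killed at `k`, with nondecreasing cost, that
vanishes at `k` is nonpositive below `k` and nonnegative above `k`. -/
theorem nonpos_and_nonneg_of_poisson (hg : Measurable g) (hk : 0 < k) (hneg : 0 < μ {x | g x < 0})
    {E : ℝ → ℝ} (hE : Measurable E) {E₀ : ℝ}
    (hE1 : ∀ r, 0 ≤ r → 1 ≤ E r) (hE0 : ∀ r, 0 ≤ r → E r ≤ E₀)
    (hEeq : ∀ r, 0 ≤ r → E r = 1 + ∫ x, (Iio k).indicator E (cusumStep g r x) ∂μ)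
    {G q : ℝ → ℝ} (hG : Measurable G) {B : ℝ}
    (hB : ∀ r, 0 ≤ r → r < k → |G r| ≤ B) (hq : MonotoneOn q (Ici 0))
    (hGq : ∀ r, 0 ≤ r → G r = q r + ∫ x, (Iio k).indicator G (cusumStep g r x) ∂μ)
    (hGk : G k = 0) : (∀ r, 0 ≤ r → r < k → G r ≤ 0) ∧ ∀ r, k ≤ r → 0 ≤ G r := by
  have hB0 : 0 ≤ B := (abs_nonneg _).trans (hB 0 le_rfl hk)
  have hcomp : ∀ s, 0 ≤ s → (∀ r, 0 ≤ r → r < k → G r ≤ s) → ∀ r₁ r₂, 0 ≤ r₁ → r₁ ≤ r₂ →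
      G r₁ - G r₂ - s ≤ 0 := by
    intro s hs0 hs r₁ r₂ h0 h12
    refine nonpos_of_le_integral (μ := μ) hg hE hE1 hE0 hEeq
      (N := fun a b => G a - G b - s) (C := B + B) (by linarith) ?_ ?_ h0 h12
    · intro a b ha hab hb
      have h1 := abs_le.1 (hB a ha (hab.trans_lt hb))
      have h2 := abs_le.1 (hB b (ha.trans hab) hb)
      linarith
    · exact fun a b ha hab => sub_sub_le_integral hg hG hB hB0 hq hGq hs0 hs ha hab
  obtain ⟨δ, hδ, hp⟩ := exists_pos_measure_le (μ := μ) (g := fun x => - g x) (c := 0)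
    (by simpa using hneg)
  set p := μ.real {x | δ ≤ - g x} with hpdef
  have hp0 : 0 < p := ENNReal.toReal_pos hp.ne' (measure_ne_top _ _)
  have hp1 : p ≤ 1 := measureReal_le_one
  have hset : MeasurableSet {x | δ ≤ - g x} := measurableSet_le measurable_const hg.neg
  -- Coalescence: `j` successive inputs with `g ≤ -δ` bring both charts to `0`, where the increment
  -- is exactly `-s`. This has probability at least `p ^ j`; on all other paths `hcomp` gives at
  -- most `0`.
  have hcoal : ∀ s, 0 ≤ s → (∀ r, 0 ≤ r → r < k → G r ≤ s) → ∀ j : ℕ, ∀ r₁ r₂, 0 ≤ r₁ →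
      r₁ ≤ r₂ → r₂ ≤ k → r₂ ≤ j * δ → G r₁ - G r₂ - s ≤ - s * p ^ j := by
    intro s hs0 hs j
    induction j with
    | zero =>
      intro r₁ r₂ h0 h12 _ hj
      have h2 : r₂ = 0 := le_antisymm (by simpa using hj) (h0.trans h12)
      have h1 : r₁ = 0 := le_antisymm (h12.trans h2.le) h0
      simp [h1, h2]
    | succ j ih =>
      intro r₁ r₂ h0 h12 hk2 hj
      refine (sub_sub_le_integral hg hG hB hB0 hq hGq hs0 hs h0 h12).trans ?_
      have hrhs : - s * p ^ (j + 1) = ∫ x, {x | δ ≤ - g x}.indicator (fun _ => - s * p ^ j) x ∂μ := by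
        rw [integral_indicator_const _ hset, ← hpdef, smul_eq_mul]; ring
      rw [hrhs]
      have hle0 : ∀ x, (if cusumStep g r₂ x < k then
          G (cusumStep g r₁ x) - G (cusumStep g r₂ x) - s else 0) ≤ 
          {x | δ ≤ - g x}.indicator (fun _ => - s * p ^ j) x := by
        intro x
        have hcx := hcomp s hs0 hs _ _ (cusumStep_nonneg g r₁ x) (cusumStep_mono g x h12)
        by_cases hx : δ ≤ - g x
        · have hstep : cusumStep g r₂ x ≤ max (r₂ - δ) 0 := max_le_max_right _ (by linarith)
          have hlt : cusumStep g r₂ x < k :=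
            hstep.trans_lt (max_lt (by linarith) hk)
          have hjj : cusumStep g r₂ x ≤ j * δ := by
            refine hstep.trans (max_le ?_ (by positivity))
            push_cast at hj; linarith
          simpa [indicator, hx, hlt] using ih _ _ (cusumStep_nonneg g r₁ x)
            (cusumStep_mono g x h12) hlt.le hjj
        · simp only [indicator, mem_ofPred_eq, hx, if_false]
          split_ifs
          · exact hcx
          · exact le_rfl
      exact integral_mono (integrable_ite_sub hg hG hB hB0 hs0 h12)
        ((integrable_const _).indicator hset) hle0
  obtain ⟨J, hJ⟩ := exists_nat_ge (k / δ)
  have hJ' : k ≤ J * δ := by rwa [div_le_iff₀ hδ] at hJ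
  set ρ := 1 - p ^ J with hρ
  have hρ0 : 0 ≤ ρ := by
    have := pow_le_one₀ hp0.le hp1 (n := J)
    linarith
  have hρ1 : ρ < 1 := by
    have := pow_pos hp0 J
    linarith
  -- With `r₂ = k` and `G k = 0`, coalescence improves a bound `s` to `s (1 - p ^ J)`; iterating
  -- drives it to `0`.
  have hdecay : ∀ n : ℕ, ∀ r, 0 ≤ r → r < k → G r ≤ B * ρ ^ n := by
    intro n
    induction n with
    | zero => intro r h0 hr; simpa using (le_abs_self _).trans (hB r h0 hr)
    | succ n ih =>
      intro r h0 hr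
      have := hcoal (B * ρ ^ n) (by positivity) ih J r k h0 hr.le le_rfl hJ'
      rw [hGk] at this
      rw [pow_succ]
      nlinarith
  have hnp : ∀ r, 0 ≤ r → r < k → G r ≤ 0 := by
    intro r h0 hr
    have hlim : Tendsto (fun n : ℕ => B * ρ ^ n) atTop (𝓝 (B * 0)) :=
      (tendsto_pow_atTop_nhds_zero_of_lt_one hρ0 hρ1).const_mul B
    simpa using ge_of_tendsto' hlim fun n => hdecay n r h0 hr
  refine ⟨hnp, fun r hr => ?_⟩
  -- Now `s = 0` is admissible, and the comparison of `k` with `r` gives `G k ≤ G r`.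
  have := hcomp 0 le_rfl hnp k r hk.le hr
  linarith

end ThresholdOptimality
-- The dual certificate for the stopping problem.
section Supersolution

variable {𝒳 : Type*} {g : 𝒳 → ℝ} {k : ℝ}

/-- Without reflection the new chart value is `r + g x`. Under reflection the likelihood ratio is
lifted from `exp (r + g x)` to `1`, and the last term takes off the excess. -/
lemma exp_mul_indicator_cusumStep (U : ℝ → ℝ) (hk : 0 < k) (r : ℝ) (x : 𝒳) :
    Real.exp (r + g x) * (Iio k).indicator U (cusumStep g r x)
      = (Iio k).indicator (fun s => Real.exp s * U s) (cusumStep g r x)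
        - U 0 * max (1 - Real.exp (r + g x)) 0 := by
  rcases le_total 0 (r + g x) with h | h
  · have h1 : cusumStep g r x = r + g x := max_eq_left h
    have h2 : max (1 - Real.exp (r + g x)) 0 = 0 :=
      max_eq_right (by linarith [Real.one_le_exp h])
    rw [h1, h2]
    by_cases hy : r + g x < k <;> simp [indicator, hy]
  · have h1 : cusumStep g r x = 0 := max_eq_right h
    have h2 : max (1 - Real.exp (r + g x)) 0 = 1 - Real.exp (r + g x) :=
      max_eq_left (by linarith [Real.exp_le_one_iff.2 h])
    rw [h1, h2]
    simp only [indicator, mem_Iio, hk, if_true, Real.exp_zero]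
    ring

variable [MeasurableSpace 𝒳] {μ : Measure 𝒳}

/-- The mean drop of the likelihood ratio below the reflecting barrier in one step. -/
noncomputable def meanReflection (μ : Measure 𝒳) (g : 𝒳 → ℝ) (r : ℝ) : ℝ≥0∞ :=
  ∫⁻ x, ENNReal.ofReal (1 - Real.exp (r + g x)) ∂μ

lemma meanReflection_antitone : Antitone (meanReflection μ g) := fun a b hab =>
  lintegral_mono fun x => ENNReal.ofReal_le_ofReal (by
    have : Real.exp (a + g x) ≤ Real.exp (b + g x) := Real.exp_le_exp.2 (by linarith)
    linarith)

lemma withDensity_exp_pos {ν : Measure 𝒳} (hg : Measurable g)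
    (hν : ν = μ.withDensity fun x => ENNReal.ofReal (Real.exp (g x)))
    (hpos : 0 < μ {x | 0 < g x}) : 0 < ν {x | 0 < g x} := by
  rw [hν, withDensity_apply _ (measurableSet_lt measurable_const hg)]
  calc 0 < μ {x | 0 < g x} := hpos
    _ = ∫⁻ _ in {x | 0 < g x}, 1 ∂μ := by simp
    _ ≤ _ := setLIntegral_mono' (measurableSet_lt measurable_const hg) fun x hx => by
      rw [← ENNReal.ofReal_one]
      exact ENNReal.ofReal_le_ofReal (Real.one_le_exp (le_of_lt hx))

variable [IsProbabilityMeasure μ]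

lemma toReal_meanExit_eq (hg : Measurable g) (hpos : 0 < μ {x | 0 < g x}) (hk : 0 < k) {r : ℝ}
    (hr : 0 ≤ r) :
    (meanExit μ g k r).toReal
      = 1 + ∫ x, (Iio k).indicator (fun s => (meanExit μ g k s).toReal) (cusumStep g r x) ∂μ := by
  have hfin : ∀ s, 0 ≤ s → meanExit μ g k s < ∞ := fun s hs => meanExit_lt_top hg hpos hk hs
  have hind : ∀ y, (Iio k).indicator (fun s => (meanExit μ g k s).toReal) y
      = ((Iio k).indicator (meanExit μ g k) y).toReal := fun y => by
    by_cases hy : y < k <;> simp [indicator, hy]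
  simp_rw [hind]
  rw [integral_toReal
    (measurable_indicator_cusumStep hg (measurable_meanExit hg) k r).aemeasurable]
  · have h := meanExit_eq_one_add (μ := μ) (k := k) hg r
    have h2 : ∫⁻ x, (Iio k).indicator (meanExit μ g k) (cusumStep g r x) ∂μ ≠ ∞ := fun h' => by
      rw [h', add_top] at h
      exact (hfin r hr).ne h
    rw [h, ENNReal.toReal_add ENNReal.one_ne_top h2, ENNReal.toReal_one]
  · exact Eventually.of_forall fun x =>
      (indicator_le_self _ _ _).trans_lt (hfin _ (cusumStep_nonneg g r x))

lemma meanReflection_le_one (r : ℝ) : meanReflection μ g r ≤ 1 := by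
  calc meanReflection μ g r ≤ ∫⁻ _, 1 ∂μ := lintegral_mono fun x => by
        rw [← ENNReal.ofReal_one]
        exact ENNReal.ofReal_le_ofReal (by linarith [Real.exp_pos (r + g x)])
    _ = 1 := by simp

lemma measurable_exp_add (hg : Measurable g) (r : ℝ) :
    Measurable fun x => Real.exp (r + g x) :=
  Real.measurable_exp.comp (measurable_const.add hg)

lemma integrable_max_one_sub_exp (hg : Measurable g) (r : ℝ) :
    Integrable (fun x => max (1 - Real.exp (r + g x)) 0) μ := by
  refine Integrable.of_bound (C := 1)
    ((measurable_const.sub (measurable_exp_add hg r)).max measurable_const).aestronglyMeasurable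
    (Eventually.of_forall fun x => ?_)
  rw [Real.norm_of_nonneg (le_max_right _ _)]
  exact max_le (by linarith [Real.exp_pos (r + g x)]) zero_le_one

lemma toReal_meanReflection (hg : Measurable g) (r : ℝ) :
    (meanReflection μ g r).toReal = ∫ x, max (1 - Real.exp (r + g x)) 0 ∂μ := by
  rw [integral_eq_lintegral_of_nonneg_ae (f := fun x => max (1 - Real.exp (r + g x)) 0)
    (Eventually.of_forall fun x => le_max_right _ _)
    (integrable_max_one_sub_exp hg r).aestronglyMeasurable]
  congr 1
  refine lintegral_congr fun x => ?_
  rcases le_total 0 (1 - Real.exp (r + g x)) with h | h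
  · rw [max_eq_left h]
  · rw [max_eq_right h, ENNReal.ofReal_zero, ENNReal.ofReal_of_nonpos h]

/-- The Poisson equation, under the law `μ`, for the mean exit time under the law `ν` with density
`exp g` weighted by the likelihood ratio. -/
lemma exp_mul_meanExit_eq {ν : Measure 𝒳} [IsProbabilityMeasure ν] (hg : Measurable g)
    (hν : ν = μ.withDensity fun x => ENNReal.ofReal (Real.exp (g x)))
    (hpos : 0 < ν {x | 0 < g x}) (hk : 0 < k) {r : ℝ} (hr : 0 ≤ r) :
    Real.exp r * (meanExit ν g k r).toReal
      = Real.exp r - (meanExit ν g k 0).toReal * (meanReflection μ g r).toReal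
        + ∫ x, (Iio k).indicator (fun s => Real.exp s * (meanExit ν g k s).toReal)
            (cusumStep g r x) ∂μ := by
  set U : ℝ → ℝ := fun s => (meanExit ν g k s).toReal with hU
  have hUmeas : Measurable U := (measurable_meanExit hg).ennreal_toReal
  have hU0 : ∀ s, 0 ≤ s → U s ≤ U 0 := fun s hs =>
    ENNReal.toReal_mono (meanExit_lt_top hg hpos hk le_rfl).ne (meanExit_antitone hs)
  have hUnn : ∀ s, 0 ≤ U s := fun s => ENNReal.toReal_nonneg
  have h1 := toReal_meanExit_eq hg hpos hk hr
  have hdens : Measurable fun x => ENNReal.ofReal (Real.exp (g x)) :=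
    (Real.measurable_exp.comp hg).ennreal_ofReal
  have h2 : ∫ x, (Iio k).indicator U (cusumStep g r x) ∂ν
      = ∫ x, Real.exp (g x) * (Iio k).indicator U (cusumStep g r x) ∂μ := by
    rw [hν, integral_withDensity_eq_integral_toReal_smul hdens
      (Eventually.of_forall fun _ => ENNReal.ofReal_lt_top)]
    refine integral_congr_ae (Eventually.of_forall fun x => ?_)
    simp only [ENNReal.toReal_ofReal (Real.exp_pos _).le, smul_eq_mul]
  have h3 : Real.exp r * ∫ x, Real.exp (g x) * (Iio k).indicator U (cusumStep g r x) ∂μ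
      = ∫ x, ((Iio k).indicator (fun s => Real.exp s * U s) (cusumStep g r x)
        - U 0 * max (1 - Real.exp (r + g x)) 0) ∂μ := by
    rw [← integral_const_mul]
    refine integral_congr_ae (Eventually.of_forall fun x => ?_)
    simp only
    rw [← exp_mul_indicator_cusumStep U hk r x, Real.exp_add, mul_assoc]
  have hint : Integrable
      (fun x => (Iio k).indicator (fun s => Real.exp s * U s) (cusumStep g r x)) μ := by
    refine integrable_indicator_cusumStep hg (f := fun s => Real.exp s * U s)
      (Real.measurable_exp.mul hUmeas) (B := Real.exp k * U 0) (fun s hs hsk => ?_)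
      (mul_nonneg (Real.exp_pos _).le (hUnn 0)) r
    rw [abs_of_nonneg (mul_nonneg (Real.exp_pos _).le (hUnn s))]
    exact mul_le_mul (Real.exp_le_exp.2 hsk.le) (hU0 s hs) (hUnn s) (Real.exp_pos _).le
  rw [integral_sub hint ((integrable_max_one_sub_exp hg r).const_mul _), integral_const_mul] at h3
  rw [toReal_meanReflection hg r]
  change Real.exp r * U r = Real.exp r - U 0 * _ + _
  change U r = _ at h1
  rw [h1, h2, mul_add, mul_one, h3]
  ring

/-- The dual certificate for the optimality of the threshold `k`. -/
theorem exists_supersolution {ν : Measure 𝒳} [IsProbabilityMeasure ν] (hg : Measurable g)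
    (hν : ν = μ.withDensity fun x => ENNReal.ofReal (Real.exp (g x)))
    (hpos : 0 < μ {x | 0 < g x}) (hneg : 0 < μ {x | g x < 0}) (hk : 0 < k) :
    ∃ (lam : ℝ≥0∞) (y : ℝ → ℝ≥0∞), lam ≠ ∞ ∧ Measurable y ∧
      y 0 + meanExit ν g k 0 = lam * meanExit μ g k 0 ∧
      ∀ r, 0 ≤ r → ∫⁻ x, y (cusumStep g r x) ∂μ
        + (meanExit ν g k 0 * meanReflection μ g r + lam) ≤ ENNReal.ofReal (Real.exp r) + y r := by
  have hposν := withDensity_exp_pos hg hν hpos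
  set E : ℝ → ℝ := fun s => (meanExit μ g k s).toReal with hEdef
  set U : ℝ → ℝ := fun s => (meanExit ν g k s).toReal with hUdef
  have hEmeas : Measurable E := (measurable_meanExit hg).ennreal_toReal
  have hUmeas : Measurable U := (measurable_meanExit hg).ennreal_toReal
  have hEfin : ∀ s, 0 ≤ s → meanExit μ g k s ≠ ∞ := fun s hs =>
    (meanExit_lt_top hg hpos hk hs).ne
  have hUfin : ∀ s, 0 ≤ s → meanExit ν g k s ≠ ∞ := fun s hs =>
    (meanExit_lt_top hg hposν hk hs).ne
  have hE0 : ∀ s, 0 ≤ s → E s ≤ E 0 := fun s hs =>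
    ENNReal.toReal_mono (hEfin 0 le_rfl) (meanExit_antitone hs)
  have hU0 : ∀ s, 0 ≤ s → U s ≤ U 0 := fun s hs =>
    ENNReal.toReal_mono (hUfin 0 le_rfl) (meanExit_antitone hs)
  have hE1 : ∀ s, 0 ≤ s → 1 ≤ E s := fun s hs => by
    simpa using ENNReal.toReal_mono (hEfin s hs) (one_le_meanExit hg s)
  have hUnn : ∀ s, 0 ≤ U s := fun s => ENNReal.toReal_nonneg
  have hEnn : ∀ s, 0 ≤ E s := fun s => ENNReal.toReal_nonneg
  have hEk := hE1 k hk.le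
  -- The multiplier is the one for which `G` vanishes at the threshold.
  set l : ℝ := Real.exp k * U k / E k with hl
  have hl0 : 0 ≤ l := by
    have := hUnn k
    have := Real.exp_pos k
    positivity
  set G : ℝ → ℝ := fun s => Real.exp s * U s - l * E s with hGdef
  set q : ℝ → ℝ := fun s => Real.exp s - U 0 * (meanReflection μ g s).toReal - l with hqdef
  have hGmeas : Measurable G := (Real.measurable_exp.mul hUmeas).sub (hEmeas.const_mul l)
  have hGk : G k = 0 := by
    have : E k ≠ 0 := by linarith
    simp only [hGdef, hl]
    field_simp
    ring
  have hVb : ∀ s, 0 ≤ s → s < k → |Real.exp s * U s| ≤ Real.exp k * U 0 := fun s hs hsk => by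
    rw [abs_of_nonneg (mul_nonneg (Real.exp_pos _).le (hUnn s))]
    exact mul_le_mul (Real.exp_le_exp.2 hsk.le) (hU0 s hs) (hUnn s) (Real.exp_pos _).le
  have hEb : ∀ s, 0 ≤ s → s < k → |E s| ≤ E 0 := fun s hs _ => by
    rw [abs_of_nonneg (hEnn s)]; exact hE0 s hs
  set B := Real.exp k * U 0 + l * E 0 with hB
  have hB0 : 0 ≤ B := by
    have := hUnn 0
    have := hEnn 0
    positivity
  have hGb : ∀ s, 0 ≤ s → s < k → |G s| ≤ B := fun s hs hsk => by
    have h1 := abs_le.1 (hVb s hs hsk)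
    have h2 : l * E s ≤ l * E 0 := mul_le_mul_of_nonneg_left (hE0 s hs) hl0
    have h3 : 0 ≤ l * E s := mul_nonneg hl0 (hEnn s)
    have h4 : 0 ≤ l * E 0 := h3.trans h2
    rw [abs_le]
    constructor <;> simp only [hGdef, hB] <;> linarith
  have hiV := fun r => integrable_indicator_cusumStep (μ := μ) (k := k) hg
    (f := fun s => Real.exp s * U s) (Real.measurable_exp.mul hUmeas) hVb
    (mul_nonneg (Real.exp_pos _).le (hUnn 0)) r
  have hiE := fun r => integrable_indicator_cusumStep (μ := μ) hg hEmeas hEb (hEnn 0) r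
  have hEeq : ∀ r, 0 ≤ r → E r = 1 + ∫ x, (Iio k).indicator E (cusumStep g r x) ∂μ :=
    fun r hr => toReal_meanExit_eq hg hpos hk hr
  have hGq : ∀ r, 0 ≤ r → G r = q r + ∫ x, (Iio k).indicator G (cusumStep g r x) ∂μ := by
    intro r hr
    have h1 : Real.exp r * U r = Real.exp r - U 0 * (meanReflection μ g r).toReal
        + ∫ x, (Iio k).indicator (fun s => Real.exp s * U s) (cusumStep g r x) ∂μ :=
      exp_mul_meanExit_eq hg hν hposν hk hr
    have h2 : ∫ x, (Iio k).indicator G (cusumStep g r x) ∂μ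
        = ∫ x, (Iio k).indicator (fun s => Real.exp s * U s) (cusumStep g r x) ∂μ
          - l * ∫ x, (Iio k).indicator E (cusumStep g r x) ∂μ := by
      rw [← integral_const_mul, ← integral_sub (hiV r) ((hiE r).const_mul l)]
      refine integral_congr_ae (Eventually.of_forall fun x => ?_)
      by_cases hx : cusumStep g r x < k <;> simp [indicator, hx, hGdef]
    have h3 := hEeq r hr
    simp only [hGdef, hqdef] at h2 ⊢
    rw [h2, h1, h3]
    ring
  -- The cost increases because `exp` does and the mean reflection decreases.
  have hq : MonotoneOn q (Ici 0) := by
    intro a _ b _ hab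
    have h1 := Real.exp_le_exp.2 hab
    have h2 : (meanReflection μ g b).toReal ≤ (meanReflection μ g a).toReal :=
      ENNReal.toReal_mono ((meanReflection_le_one a).trans_lt ENNReal.one_lt_top).ne
        (meanReflection_antitone hab)
    have h3 := mul_le_mul_of_nonneg_left h2 (hUnn 0)
    simp only [hqdef]
    linarith
  obtain ⟨hnp, hnn⟩ := nonpos_and_nonneg_of_poisson hg hk hneg hEmeas hE1 hE0 hEeq hGmeas hGb hq
    hGq hGk
  -- The certificate is `-G` in the continuation region `s < k` and `0` in the stopping region.
  refine ⟨ENNReal.ofReal l, (Iio k).indicator fun s => ENNReal.ofReal (- G s),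
    ENNReal.ofReal_ne_top, hGmeas.neg.ennreal_ofReal.indicator measurableSet_Iio, ?_, ?_⟩
  · have hG0 := hnp 0 le_rfl hk
    rw [indicator_of_mem (by simpa using hk), ← ENNReal.ofReal_toReal (hUfin 0 le_rfl),
      ← ENNReal.ofReal_toReal (hEfin 0 le_rfl), ← ENNReal.ofReal_mul hl0,
      ← ENNReal.ofReal_add (by linarith) ENNReal.toReal_nonneg]
    congr 1
    simp only [hGdef, Real.exp_zero, hEdef, hUdef]
    ring
  · intro r hr
    have h1 : q r - G r = ∫ x, - (Iio k).indicator G (cusumStep g r x) ∂μ := by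
      rw [integral_neg, hGq r hr]; ring
    have hint : ∫⁻ x, (Iio k).indicator (fun s => ENNReal.ofReal (- G s)) (cusumStep g r x) ∂μ
        = ENNReal.ofReal (q r - G r) := by
      rw [h1, ofReal_integral_eq_lintegral_ofReal
        (f := fun x => - (Iio k).indicator G (cusumStep g r x))
        (integrable_indicator_cusumStep hg hGmeas hGb hB0 r).neg]
      · refine lintegral_congr fun x => ?_
        by_cases hx : cusumStep g r x < k <;> simp [indicator, hx]
      · refine Eventually.of_forall fun x => ?_
        by_cases hx : cusumStep g r x < k
        · simpa [indicator, hx] using hnp _ (cusumStep_nonneg g r x) hx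
        · simp [indicator, hx]
    have hqG : 0 ≤ q r - G r := by
      rw [h1]
      refine integral_nonneg fun x => ?_
      by_cases hx : cusumStep g r x < k
      · simpa [indicator, hx] using hnp _ (cusumStep_nonneg g r x) hx
      · simp [indicator, hx]
    have hψ : meanReflection μ g r ≠ ∞ :=
      ((meanReflection_le_one r).trans_lt ENNReal.one_lt_top).ne
    have hψ0 : 0 ≤ (meanReflection μ g r).toReal := ENNReal.toReal_nonneg
    rw [hint, ← ENNReal.ofReal_toReal (hUfin 0 le_rfl), ← ENNReal.ofReal_toReal hψ,
      ← ENNReal.ofReal_mul (hUnn 0),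
      ← ENNReal.ofReal_add (mul_nonneg (hUnn 0) hψ0) hl0,
      ← ENNReal.ofReal_add hqG (add_nonneg (mul_nonneg (hUnn 0) hψ0) hl0)]
    have hsum : q r - G r + (U 0 * (meanReflection μ g r).toReal + l) = Real.exp r + - G r := by
      simp only [hqdef]; ring
    change ENNReal.ofReal (q r - G r + (U 0 * (meanReflection μ g r).toReal + l)) ≤ _
    rw [hsum]
    -- Equality holds below `k`; above `k` the inequality is `-G r ≤ 0`.
    by_cases hrk : r < k
    · rw [indicator_of_mem (by simpa using hrk),
        ENNReal.ofReal_add (Real.exp_pos _).le (by linarith [hnp r hr hrk])]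
    · refine le_self_add.trans' (ENNReal.ofReal_le_ofReal ?_)
      linarith [hnn r (not_lt.1 hrk)]

end Supersolution
-- The observation filtration, independence and change of measure.
section ObsSigma

variable {Ω 𝒳 : Type*} [MeasurableSpace 𝒳] {X : ℕ → Ω → 𝒳}

lemma obsSigma_mono : Monotone (obsSigma X) := fun a b hab =>
  biSup_mono fun s hs => by
    rw [Finset.mem_Icc] at hs ⊢
    omega

lemma measurable_obs {s t : ℕ} (hs : 1 ≤ s) (hst : s ≤ t) : Measurable[obsSigma X t] (X s) := by
  rw [measurable_iff_comap_le]
  exact le_biSup (fun s => MeasurableSpace.comap (X s) inferInstance) (Finset.mem_Icc.2 ⟨hs, hst⟩)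

lemma obsSigma_zero : obsSigma X 0 = ⊥ := by simp [obsSigma]

lemma obsSigma_succ_le (t : ℕ) :
    obsSigma X (t + 1) ≤ obsSigma X t ⊔ MeasurableSpace.comap (X (t + 1)) inferInstance := by
  refine iSup₂_le fun s hs => ?_
  rw [Finset.mem_Icc] at hs
  rcases Nat.lt_or_ge t s with h | h
  · obtain rfl : s = t + 1 := by omega
    exact le_sup_right
  · exact le_sup_of_le_left (measurable_iff_comap_le.1 (measurable_obs hs.1 h))

/-- Every function of `X 1, …, X (t + 1)` is a function of `X (t + 1)` with coefficients depending
on `X 1, …, X t`. -/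
lemma exists_eq_comp_obs_succ (t : ℕ) {V : Ω → ℝ≥0∞} (hV : Measurable[obsSigma X (t + 1)] V) :
    ∃ f : Ω × 𝒳 → ℝ≥0∞, Measurable[(obsSigma X t).prod inferInstance] f ∧
      V = fun ω => f (ω, X (t + 1) ω) := by
  have hle : obsSigma X (t + 1) ≤ MeasurableSpace.comap (fun ω => (ω, X (t + 1) ω))
      ((obsSigma X t).prod inferInstance) := by
    refine (obsSigma_succ_le t).trans ?_
    rw [MeasurableSpace.prod, MeasurableSpace.comap_sup, MeasurableSpace.comap_comp,
      MeasurableSpace.comap_comp]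
    exact sup_le_sup (le_of_eq MeasurableSpace.comap_id.symm) le_rfl
  obtain ⟨f, hf, hfV⟩ := Measurable.exists_eq_measurable_comp
    (mY := (obsSigma X t).prod inferInstance) (hV.mono hle le_rfl)
  exact ⟨f, hf, hfV⟩

lemma measurable_lintegral_obs (t : ℕ) {f : Ω × 𝒳 → ℝ≥0∞} (ν : Measure 𝒳) [SFinite ν]
    (hf : Measurable[(obsSigma X t).prod inferInstance] f) :
    Measurable[obsSigma X t] fun ω => ∫⁻ x, f (ω, x) ∂ν :=
  @Measurable.lintegral_prod_right' Ω 𝒳 (obsSigma X t) _ ν _ f hf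

variable [MeasurableSpace Ω]

lemma obsSigma_le (hX : ∀ t, 1 ≤ t → Measurable (X t)) (t : ℕ) : obsSigma X t ≤ ‹_› :=
  iSup₂_le fun s hs => (hX s (Finset.mem_Icc.1 hs).1).comap_le

variable {F : Fin 2 → Measure 𝒳} {P : Measure Ω}

lemma IsObservationLaw.indep_obsSigma (hP : IsObservationLaw F X P)
    (hX : ∀ t, 1 ≤ t → Measurable (X t)) (t : ℕ) :
    Indep (obsSigma X t) (MeasurableSpace.comap (X (t + 1)) inferInstance) P := by
  have h := indep_iSup_of_disjoint (μ := P)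
    (m := fun s : ℕ => MeasurableSpace.comap (X (s + 1)) inferInstance)
    (fun s => (hX (s + 1) (by omega)).comap_le) hP.iIndepFun
    (S := Iio t) (T := {t}) (by simp)
  refine indep_of_indep_of_le_left (indep_of_indep_of_le_right h (by simp)) ?_
  refine iSup₂_le fun s hs => ?_
  rw [Finset.mem_Icc] at hs
  obtain ⟨s, rfl⟩ : ∃ s', s = s' + 1 := ⟨s - 1, by omega⟩
  exact le_biSup (fun s => MeasurableSpace.comap (X (s + 1)) inferInstance)
    (show s ∈ Iio t by simp; omega)

lemma lintegral_comp_prodMk_of_indepFun {α : Type*} [MeasurableSpace α] [IsProbabilityMeasure P]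
    {Z : Ω → α} {Y : Ω → 𝒳} (hZ : Measurable Z) (hY : Measurable Y) (h : IndepFun Z Y P)
    {f : α × 𝒳 → ℝ≥0∞} (hf : Measurable f) :
    ∫⁻ ω, f (Z ω, Y ω) ∂P = ∫⁻ ω, ∫⁻ x, f (Z ω, x) ∂(P.map Y) ∂P := by
  have hYp := Measure.isProbabilityMeasure_map (μ := P) hY.aemeasurable
  have hZp := Measure.isProbabilityMeasure_map (μ := P) hZ.aemeasurable
  rw [← lintegral_map hf (hZ.prodMk hY),
    (indepFun_iff_map_prod_eq_prod_map_map hZ.aemeasurable hY.aemeasurable).1 h,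
    lintegral_prod _ hf.aemeasurable, lintegral_map hf.lintegral_prod_right' hZ]

/-- Integrating out the observation `X (t + 1)` given the past. -/
lemma IsObservationLaw.lintegral_obs_succ (hP : IsObservationLaw F X P)
    (hX : ∀ t, 1 ≤ t → Measurable (X t)) (t : ℕ) {f : Ω × 𝒳 → ℝ≥0∞}
    (hf : Measurable[(obsSigma X t).prod inferInstance] f) :
    ∫⁻ ω, f (ω, X (t + 1) ω) ∂P = ∫⁻ ω, ∫⁻ x, f (ω, x) ∂(P.map (X (t + 1))) ∂P := by
  have := hP.isProbabilityMeasure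
  -- The past is represented by the identity map into `Ω` equipped with the smaller σ-algebra.
  refine @lintegral_comp_prodMk_of_indepFun Ω 𝒳 _ _ P Ω (obsSigma X t) _ id (X (t + 1))
    (measurable_id'' (obsSigma_le hX t)) (hX _ (by omega)) ?_ f hf
  refine (@IndepFun_iff_Indep Ω Ω 𝒳 _ (obsSigma X t) _ id (X (t + 1)) P).2 ?_
  rw [MeasurableSpace.comap_id]
  exact hP.indep_obsSigma hX t

/-- Change of measure between two laws of the observations. -/
lemma IsObservationLaw.lintegral_eq_lintegral_mul_prod {P' : Measure Ω}
    (hP : IsObservationLaw F X P) (hP' : IsObservationLaw F X P')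
    (hX : ∀ t, 1 ≤ t → Measurable (X t)) {ρ : ℕ → 𝒳 → ℝ≥0∞} (hρ : ∀ t, Measurable (ρ t))
    (hPP' : ∀ t, P.map (X (t + 1)) = (P'.map (X (t + 1))).withDensity (ρ t)) (t : ℕ)
    {V : Ω → ℝ≥0∞} (hV : Measurable[obsSigma X t] V) :
    ∫⁻ ω, V ω ∂P = ∫⁻ ω, V ω * ∏ i ∈ Finset.range t, ρ i (X (i + 1) ω) ∂P' := by
  have := hP.isProbabilityMeasure
  have := hP'.isProbabilityMeasure
  induction t generalizing V with
  | zero =>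
    rw [obsSigma_zero] at hV
    obtain ⟨c, rfl⟩ := stronglyMeasurable_bot_iff.1 hV.stronglyMeasurable
    simp
  | succ t ih =>
    obtain ⟨f, hf, rfl⟩ := exists_eq_comp_obs_succ t hV
    have hXp := Measure.isProbabilityMeasure_map (μ := P) (hX (t + 1) (by omega)).aemeasurable
    have hXp' := Measure.isProbabilityMeasure_map (μ := P') (hX (t + 1) (by omega)).aemeasurable
    have hprod : Measurable[obsSigma X t] fun ω => ∏ i ∈ Finset.range t, ρ i (X (i + 1) ω) := by
      refine @Finset.measurable_fun_prod _ _ _ _ _ _ (obsSigma X t) _ _ fun i hi => ?_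
      rw [Finset.mem_range] at hi
      exact (hρ i).comp (measurable_obs (by omega) (by omega))
    have hfx : ∀ ω, Measurable fun x => f (ω, x) := fun ω =>
      hf.comp (@measurable_prodMk_left _ _ (obsSigma X t) _ ω)
    -- After the newest observation is integrated out, the integrand depends on the past only, and
    -- the induction hypothesis applies.
    rw [hP.lintegral_obs_succ hX t hf, ih (measurable_lintegral_obs t _ hf)]
    have hF : Measurable[(obsSigma X t).prod inferInstance] fun p : Ω × 𝒳 =>
        f p * ((∏ i ∈ Finset.range t, ρ i (X (i + 1) p.1)) * ρ t p.2) :=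
      hf.mul ((hprod.comp (@measurable_fst _ _ (obsSigma X t) _)).mul
        ((hρ t).comp (@measurable_snd _ _ (obsSigma X t) _)))
    have h2 := hP'.lintegral_obs_succ hX t hF
    simp only [Finset.prod_range_succ]
    rw [h2]
    refine lintegral_congr fun ω => ?_
    rw [hPP' t, lintegral_withDensity_eq_lintegral_mul _ (hρ t) (hfx ω),
      ← lintegral_mul_const _ ((hρ t).mul (hfx ω))]
    refine lintegral_congr fun x => ?_
    simp only [Pi.mul_apply]
    ring

end ObsSigma

/-- On `m`-measurable sets the measure with density `f` is at most `d • P`; integrating the weight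
`W` against both trimmed measures gives the claim. -/
lemma lintegral_mul_le_of_condLExp_le {Ω : Type*} {m mΩ : MeasurableSpace Ω} (hm : m ≤ mΩ)
    {P : Measure[mΩ] Ω} [IsProbabilityMeasure P] {f W : Ω → ℝ≥0∞} (hf : Measurable f) (hW : Measurable[m] W)
    {d : ℝ≥0∞} (hd : ∀ᵐ ω ∂P, condLExp m P f ω ≤ d) :
    ∫⁻ ω, W ω * f ω ∂P ≤ d * ∫⁻ ω, W ω ∂P := by
  have hle : (P.withDensity f).trim hm ≤ d • P.trim hm := by
    refine Measure.le_iff.2 fun s hs => ?_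
    rw [trim_measurableSet_eq hm hs, withDensity_apply _ (hm s hs), Measure.smul_apply,
      trim_measurableSet_eq hm hs, smul_eq_mul, ← setLIntegral_condLExp hm P f hs]
    calc ∫⁻ ω in s, condLExp m P f ω ∂P ≤ ∫⁻ _ in s, d ∂P :=
          lintegral_mono_ae (ae_restrict_of_ae hd)
      _ = d * P s := by simp
  have h := lintegral_mono' hle (le_refl W)
  rw [lintegral_smul_measure, lintegral_trim hm hW, lintegral_trim hm hW,
    lintegral_withDensity_eq_lintegral_mul _ hf (hW.mono hm le_rfl)] at h
  simpa [mul_comm] using h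

/-! ### Delays as sums of no-signal indicators. -/

section Delay

variable {Ω : Type*} {Z : ℕ → Ω → Set (Fin 2)} {j : Fin 2}

open Classical in
/-- The indicator of the event that `Z` does not signal `j` at any of the `i` times from `n` on. -/
noncomputable def noSignal (Z : ℕ → Ω → Set (Fin 2)) (j : Fin 2) (n i : ℕ) (ω : Ω) : ℝ≥0∞ :=
  if ∀ t, n ≤ t → t < n + i → j ∉ Z t ω then 1 else 0

lemma noSignal_zero (n : ℕ) (ω : Ω) : noSignal Z j n 0 ω = 1 :=
  if_pos fun t h1 h2 => by omega

lemma noSignal_le_one (n i : ℕ) (ω : Ω) : noSignal Z j n i ω ≤ 1 := by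
  unfold noSignal; split_ifs <;> simp

lemma noSignal_add (n a b : ℕ) (ω : Ω) :
    noSignal Z j n (a + b) ω = noSignal Z j n a ω * noSignal Z j (n + a) b ω := by
  unfold noSignal
  by_cases h1 : ∀ t, n ≤ t → t < n + a → j ∉ Z t ω
  · by_cases h2 : ∀ t, n + a ≤ t → t < n + a + b → j ∉ Z t ω
    · have h : ∀ t, n ≤ t → t < n + (a + b) → j ∉ Z t ω := fun t ht ht' => by
        rcases lt_or_ge t (n + a) with hlt | hge
        · exact h1 t ht hlt
        · exact h2 t hge (by omega)
      rw [if_pos h, if_pos h1, if_pos h2, one_mul]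
    · rw [if_neg h2, mul_zero, if_neg]
      exact fun h => h2 fun t ht ht' => h t (by omega) (by omega)
  · rw [if_neg h1, zero_mul, if_neg]
    exact fun h => h1 fun t ht ht' => h t ht (by omega)

lemma noSignal_succ_le (n i : ℕ) (ω : Ω) : noSignal Z j n (i + 1) ω ≤ noSignal Z j n i ω := by
  rw [noSignal_add]
  exact mul_le_of_le_one_right' (noSignal_le_one _ _ _)

/-- The `i`-th term is the indicator of `τ ≥ n + i`. The term `i = 0` is always `1` and accounts for
the `+ 1` in the delay. -/
lemma delay_eq_tsum (n : ℕ) (ω : Ω) : delay Z j n ω = ∑' i, noSignal Z j n i ω := by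
  classical
  unfold delay
  by_cases h : ∃ t, n ≤ t ∧ j ∈ Z t ω
  · have hfs : firstSignal Z j n ω = (Nat.find h : ℕ) := by
      refine le_antisymm (iInf₂_le (Nat.find h) (Nat.find_spec h)) ?_
      exact le_iInf₂ fun t ht => Nat.cast_le.2 (Nat.find_min' h ht)
    have hn := (Nat.find_spec h).1
    have hval : ((firstSignal Z j n ω - (n : ℕ∞) + 1 : ℕ∞) : ℝ≥0∞)
        = ((Nat.find h - n + 1 : ℕ) : ℝ≥0∞) := by
      rw [hfs]; norm_cast
    rw [hval, tsum_eq_sum (s := Finset.range (Nat.find h - n + 1))]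
    · rw [Finset.sum_congr rfl (g := fun _ => 1)]
      · simp
      · intro i hi
        rw [Finset.mem_range] at hi
        refine if_pos fun t h1 h2 hj => ?_
        have := Nat.find_min' h ⟨h1, hj⟩
        omega
    · intro i hi
      rw [Finset.mem_range] at hi
      refine if_neg fun hall => hall (Nat.find h) hn ?_ (Nat.find_spec h).2
      omega
  · have hfs : firstSignal Z j n ω = ⊤ := by
      simp only [firstSignal, iInf_eq_top]
      exact fun t ht => absurd ⟨t, ht⟩ h
    have hone : ∀ i, noSignal Z j n i ω = 1 := fun i =>
      if_pos fun t ht _ hj => h ⟨t, ht, hj⟩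
    simp_rw [hone, hfs]
    rw [ENNReal.tsum_const_eq_top_of_ne_zero one_ne_zero]
    simp

variable {𝒳 : Type*} [MeasurableSpace 𝒳] {X : ℕ → Ω → 𝒳}

lemma measurable_noSignal (hZ : IsSignalProcess X Z) (j : Fin 2) {n : ℕ} (hn : 1 ≤ n) (i : ℕ) :
    Measurable[obsSigma X (n + i - 1)] (noSignal Z j n i) := by
  classical
  refine Measurable.ite ?_ measurable_const measurable_const
  have hset : {ω | ∀ t, n ≤ t → t < n + i → j ∉ Z t ω}
      = ⋂ t ∈ Finset.Ico n (n + i), {ω | j ∈ Z t ω}ᶜ := by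
    ext ω; simp
  rw [hset]
  refine @Finset.measurableSet_biInter _ _ (obsSigma X (n + i - 1)) _ _ fun t ht => ?_
  rw [Finset.mem_Ico] at ht
  exact (obsSigma_mono (by omega) _ (hZ t (by omega) j)).compl

variable [MeasurableSpace Ω]

lemma measurable_delay (hX : ∀ t, 1 ≤ t → Measurable (X t)) (hZ : IsSignalProcess X Z) (j : Fin 2)
    {n : ℕ} (hn : 1 ≤ n) : Measurable (delay Z j n) := by
  have : delay Z j n = fun ω => ∑' i, noSignal Z j n i ω := funext (delay_eq_tsum n)
  rw [this]
  exact Measurable.tsum fun i => (measurable_noSignal hZ j hn i).mono (obsSigma_le hX _) le_rfl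

end Delay
-- Performance of threshold signals based on the capped chart.
section CappedChart

variable {Ω 𝒳 : Type*} {X : ℕ → Ω → 𝒳} {g : 𝒳 → ℝ} {h : ℝ}

/-- The CUSUM chart with score `g`, holding barriers `0` and `h`, started at `0`. -/
noncomputable def cappedCusum (g : 𝒳 → ℝ) (X : ℕ → Ω → 𝒳) (h : ℝ) : ℕ → Ω → ℝ
  | 0, _ => 0
  | t + 1, ω => min (cusumStep g (cappedCusum g X h t ω) (X (t + 1) ω)) h

lemma cappedCusum_nonneg (hh : 0 ≤ h) (t : ℕ) (ω : Ω) : 0 ≤ cappedCusum g X h t ω := by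
  cases t with
  | zero => exact le_rfl
  | succ t => exact le_min (cusumStep_nonneg _ _ _) hh

variable [MeasurableSpace 𝒳]

lemma measurable_cappedCusum (hg : Measurable g) (t : ℕ) :
    Measurable[obsSigma X t] (cappedCusum g X h t) := by
  induction t with
  | zero => exact measurable_const
  | succ t ih =>
    exact ((measurable_cusumStep_uncurry hg).comp
      ((ih.mono (obsSigma_mono t.le_succ) le_rfl).prodMk (measurable_obs (by omega) le_rfl))).min
        measurable_const

lemma measurable_comp_cusumStep (hg : Measurable g) {t : ℕ} {R : Ω → ℝ} {W : Ω → ℝ≥0∞}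
    {f : ℝ → ℝ≥0∞} (hR : Measurable[obsSigma X t] R) (hW : Measurable[obsSigma X t] W)
    (hf : Measurable f) : Measurable[(obsSigma X t).prod inferInstance]
      fun p : Ω × 𝒳 => W p.1 * f (cusumStep g (R p.1) p.2) :=
  (hW.comp (@measurable_fst _ _ (obsSigma X t) _)).mul
    (hf.comp ((measurable_cusumStep_uncurry hg).comp
      ((hR.comp (@measurable_fst _ _ (obsSigma X t) _)).prodMk
        (@measurable_snd _ _ (obsSigma X t) _))))

end CappedChart

section Capped

variable {Ω 𝒳 : Type*} [MeasurableSpace Ω] [MeasurableSpace 𝒳] {F : Fin 2 → Measure 𝒳}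
  {X : ℕ → Ω → 𝒳} {P : Measure Ω} {g : 𝒳 → ℝ} {h k : ℝ}

lemma IsObservationLaw.lintegral_mul_comp_cusumStep (hP : IsObservationLaw F X P)
    (hX : ∀ t, 1 ≤ t → Measurable (X t)) (hg : Measurable g) {t : ℕ} {R : Ω → ℝ} {W : Ω → ℝ≥0∞}
    {f : ℝ → ℝ≥0∞} (hR : Measurable[obsSigma X t] R) (hW : Measurable[obsSigma X t] W)
    (hf : Measurable f) :
    ∫⁻ ω, W ω * f (cusumStep g (R ω) (X (t + 1) ω)) ∂P
      = ∫⁻ ω, W ω * ∫⁻ x, f (cusumStep g (R ω) x) ∂(P.map (X (t + 1))) ∂P := by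
  rw [hP.lintegral_obs_succ hX t (measurable_comp_cusumStep hg hR hW hf)]
  refine lintegral_congr fun ω => ?_
  exact lintegral_const_mul (W ω) (f := fun x => f (cusumStep g (R ω) x))
    (hf.comp (measurable_cusumStep hg _))

variable {Z : ℕ → Ω → Set (Fin 2)} {j : Fin 2}

/-- Markov property, tested against weights `W` from the past. In the induction the event of no
signal at time `m + 1` is absorbed into the weight, so `m` and `W` must vary. -/
lemma IsObservationLaw.lintegral_mul_noSignal (hP : IsObservationLaw F X P)
    (hX : ∀ t, 1 ≤ t → Measurable (X t)) (hg : Measurable g) (hkh : k ≤ h)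
    (hZ : ∀ᵐ ω ∂P, ∀ t, 1 ≤ t → (j ∈ Z t ω ↔ k ≤ cappedCusum g X h t ω))
    {ν : Measure 𝒳} [IsProbabilityMeasure ν] {m : ℕ} (hν : ∀ t, m + 1 ≤ t → P.map (X t) = ν)
    (i : ℕ) {W : Ω → ℝ≥0∞} (hW : Measurable[obsSigma X m] W) :
    ∫⁻ ω, W ω * noSignal Z j (m + 1) i ω ∂P
      = ∫⁻ ω, W ω * surv ν g k i (cappedCusum g X h m ω) ∂P := by
  induction i generalizing m W with
  | zero => simp [noSignal_zero, surv]
  | succ i ih =>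
    have hR := measurable_cappedCusum (X := X) (h := h) hg (m + 1)
    have hind : Measurable[obsSigma X (m + 1)] fun ω =>
        W ω * (Iio k).indicator (fun _ => (1 : ℝ≥0∞)) (cappedCusum g X h (m + 1) ω) :=
      (hW.mono (obsSigma_mono m.le_succ) le_rfl).mul
        ((measurable_const.indicator measurableSet_Iio).comp hR)
    calc ∫⁻ ω, W ω * noSignal Z j (m + 1) (i + 1) ω ∂P
        = ∫⁻ ω, (W ω * (Iio k).indicator (fun _ => (1 : ℝ≥0∞)) (cappedCusum g X h (m + 1) ω))
            * noSignal Z j (m + 1 + 1) i ω ∂P := by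
          refine lintegral_congr_ae ?_
          classical
          filter_upwards [hZ] with ω hω
          rw [add_comm i 1, noSignal_add, mul_assoc]
          congr 2
          have h1 : noSignal Z j (m + 1) 1 ω = if j ∈ Z (m + 1) ω then 0 else 1 := by
            unfold noSignal
            by_cases hj : j ∈ Z (m + 1) ω
            · rw [if_pos hj, if_neg]
              exact fun hh => hh (m + 1) le_rfl (by omega) hj
            · rw [if_neg hj, if_pos]
              intro t h1 h2
              obtain rfl : t = m + 1 := by omega
              exact hj
          rw [h1]
          by_cases hj : k ≤ cappedCusum g X h (m + 1) ω
          · simp [(hω (m + 1) (by omega)).2 hj, indicator, hj]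
          · simp [mt (hω (m + 1) (by omega)).1 hj, indicator, not_le.1 hj]
      _ = ∫⁻ ω, (W ω * (Iio k).indicator (fun _ => (1 : ℝ≥0∞)) (cappedCusum g X h (m + 1) ω))
            * surv ν g k i (cappedCusum g X h (m + 1) ω) ∂P :=
          ih (fun t ht => hν t (by omega)) hind
      _ = ∫⁻ ω, W ω * (Iio k).indicator (surv ν g k i)
            (cusumStep g (cappedCusum g X h m ω) (X (m + 1) ω)) ∂P := by
          refine lintegral_congr fun ω => ?_
          rw [mul_assoc]
          congr 1
          set y := cusumStep g (cappedCusum g X h m ω) (X (m + 1) ω) with hy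
          have hc : cappedCusum g X h (m + 1) ω = min y h := rfl
          rw [hc]
          -- Below `k ≤ h` the cap is inactive; from `k` on both indicators vanish, capped or not.
          by_cases hlt : y < k
          · rw [min_eq_left (hlt.le.trans hkh)]
            simp [indicator, hlt]
          · have : ¬ min y h < k := not_lt.2 (le_min (not_lt.1 hlt) hkh)
            simp only [indicator, mem_Iio, this, hlt, if_false, zero_mul]
      _ = _ := by
          rw [hP.lintegral_mul_comp_cusumStep hX hg (measurable_cappedCusum hg m) hW
            ((measurable_surv hg i).indicator measurableSet_Iio), hν (m + 1) le_rfl]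
          rfl

/-- The conditional mean delay of a threshold signal is a function of the chart. -/
lemma IsObservationLaw.condLExp_delay (hP : IsObservationLaw F X P)
    (hX : ∀ t, 1 ≤ t → Measurable (X t)) (hg : Measurable g) (hkh : k ≤ h)
    (hZs : IsSignalProcess X Z)
    (hZ : ∀ᵐ ω ∂P, ∀ t, 1 ≤ t → (j ∈ Z t ω ↔ k ≤ cappedCusum g X h t ω))
    {ν : Measure 𝒳} [IsProbabilityMeasure ν] {m : ℕ} (hν : ∀ t, m + 1 ≤ t → P.map (X t) = ν) :
    (fun ω => meanExit ν g k (cappedCusum g X h m ω))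
      =ᵐ[P] condLExp (obsSigma X m) P (delay Z j (m + 1)) := by
  have := hP.isProbabilityMeasure
  have hR := measurable_cappedCusum (X := X) (h := h) hg m
  refine ae_eq_condLExp (obsSigma_le hX m) P _ ((measurable_meanExit hg).comp hR) fun s hs => ?_
  have hs' := obsSigma_le hX m s hs
  rw [← lintegral_indicator hs', ← lintegral_indicator hs']
  have hW : Measurable[obsSigma X m] (s.indicator fun _ => (1 : ℝ≥0∞)) :=
    measurable_const.indicator hs
  have hmul : ∀ (f : Ω → ℝ≥0∞) (ω : Ω), s.indicator f ω = s.indicator (fun _ => 1) ω * f ω :=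
    fun f ω => by by_cases hω : ω ∈ s <;> simp [hω]
  simp_rw [hmul (fun ω => meanExit ν g k (cappedCusum g X h m ω)), hmul (delay Z j (m + 1)),
    delay_eq_tsum, meanExit, ← ENNReal.tsum_mul_left]
  rw [lintegral_tsum fun i => ?_, lintegral_tsum fun i => ?_]
  · exact tsum_congr fun i => (hP.lintegral_mul_noSignal hX hg hkh hZ hν i hW).symm
  · exact ((hW.mono (obsSigma_le hX m) le_rfl).mul ((measurable_noSignal hZs j (by omega) i).mono
      (obsSigma_le hX _) le_rfl)).aemeasurable
  · exact ((hW.mono (obsSigma_le hX m) le_rfl).mul ((measurable_surv hg i).comp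
      (hR.mono (obsSigma_le hX _) le_rfl))).aemeasurable

lemma IsObservationLaw.worstMeanDelay_le (hP : IsObservationLaw F X P)
    (hX : ∀ t, 1 ≤ t → Measurable (X t)) (hg : Measurable g) (hkh : k ≤ h) (hh : 0 ≤ h)
    (hZs : IsSignalProcess X Z)
    (hZ : ∀ᵐ ω ∂P, ∀ t, 1 ≤ t → (j ∈ Z t ω ↔ k ≤ cappedCusum g X h t ω))
    {ν : Measure 𝒳} [IsProbabilityMeasure ν] {m : ℕ} (hν : ∀ t, m + 1 ≤ t → P.map (X t) = ν) :
    worstMeanDelay X P Z j (m + 1) ≤ meanExit ν g k 0 := by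
  refine essSup_le_of_ae_le _ ?_
  filter_upwards [hP.condLExp_delay hX hg hkh hZs hZ hν] with ω hω
  rw [Nat.add_sub_cancel, ← hω]
  exact meanExit_antitone (cappedCusum_nonneg hh m ω)

/-- Independent inputs with negative score hold the chart at its starting value `0`. -/
lemma IsObservationLaw.measure_cappedCusum_eq_zero_pos (hP : IsObservationLaw F X P)
    (hX : ∀ t, 1 ≤ t → Measurable (X t)) (hg : Measurable g) (hh : 0 ≤ h) {ν : Measure 𝒳}
    (hneg : 0 < ν {x | g x < 0}) (hν : ∀ t, 1 ≤ t → P.map (X t) = ν) (m : ℕ) :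
    0 < P {ω | cappedCusum g X h m ω = 0} := by
  have := hP.isProbabilityMeasure
  induction m with
  | zero => simp [cappedCusum]
  | succ m ih =>
    have hset : MeasurableSet {x | g x < 0} := measurableSet_lt hg measurable_const
    have hind := (Indep_iff _ _ _).1 (hP.indep_obsSigma hX m) {ω | cappedCusum g X h m ω = 0}
      (X (m + 1) ⁻¹' {x | g x < 0})
      ((measurable_cappedCusum hg m) (measurableSet_singleton 0)) ⟨_, hset, rfl⟩
    rw [← Measure.map_apply (hX (m + 1) (by omega)) hset, hν (m + 1) (by omega)] at hind
    refine (ENNReal.mul_pos ih.ne' hneg.ne').trans_le (hind.symm.le.trans (measure_mono ?_))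
    rintro ω ⟨h1, h2⟩
    have h1' : cappedCusum g X h m ω = 0 := h1
    have h2' : g (X (m + 1) ω) < 0 := h2
    change min (max (cappedCusum g X h m ω + g (X (m + 1) ω)) 0) h = 0
    rw [h1', zero_add, max_eq_right h2'.le, min_eq_left hh]

/-- The worst chart value `0` has positive probability at each time, so the essential supremum
cannot miss it. -/
lemma IsObservationLaw.le_worstMeanDelay (hP : IsObservationLaw F X P)
    (hX : ∀ t, 1 ≤ t → Measurable (X t)) (hg : Measurable g) (hkh : k ≤ h) (hh : 0 ≤ h)
    (hZs : IsSignalProcess X Z)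
    (hZ : ∀ᵐ ω ∂P, ∀ t, 1 ≤ t → (j ∈ Z t ω ↔ k ≤ cappedCusum g X h t ω))
    {ν : Measure 𝒳} [IsProbabilityMeasure ν] (hneg : 0 < ν {x | g x < 0})
    (hν : ∀ t, 1 ≤ t → P.map (X t) = ν) (m : ℕ) :
    meanExit ν g k 0 ≤ worstMeanDelay X P Z j (m + 1) := by
  by_contra! hlt
  refine (hP.measure_cappedCusum_eq_zero_pos hX hg hh hneg hν m).ne' ?_
  have hae : ∀ᵐ ω ∂P, cappedCusum g X h m ω ≠ 0 := by
    filter_upwards [hP.condLExp_delay hX hg hkh hZs hZ (m := m) (fun t ht => hν t (by omega)),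
      ENNReal.ae_le_essSup (μ := P) (condLExp (obsSigma X m) P (delay Z j (m + 1)))] with ω h1 h2 h0
    rw [← h1, h0] at h2
    exact absurd hlt (not_lt.2 h2)
  rw [ae_iff] at hae
  simpa using hae

end Capped
-- The lower bound on the worst delay of an arbitrary signal process.
section Cusum

variable {Ω 𝒳 : Type*}

/-- The CUSUM chart with score `g` and no upper barrier, started at `0`. -/
noncomputable def cusum (g : 𝒳 → ℝ) (X : ℕ → Ω → 𝒳) : ℕ → Ω → ℝ
  | 0, _ => 0
  | t + 1, ω => cusumStep g (cusum g X t ω) (X (t + 1) ω)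

/-- The amount by which the likelihood ratio is lifted by the reflection at time `t`. -/
noncomputable def reflectionWeight (g : 𝒳 → ℝ) (X : ℕ → Ω → 𝒳) : ℕ → Ω → ℝ≥0∞
  | 0, _ => 1
  | t + 1, ω => ENNReal.ofReal (1 - Real.exp (cusum g X t ω + g (X (t + 1) ω)))

/-- The likelihood ratio of the `i` observations after time `m`. -/
noncomputable def likelihoodRatio (g : 𝒳 → ℝ) (X : ℕ → Ω → 𝒳) (m i : ℕ) (ω : Ω) : ℝ≥0∞ :=
  ∏ l ∈ Finset.range i, ENNReal.ofReal (Real.exp (g (X (m + l + 1) ω)))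

variable {X : ℕ → Ω → 𝒳} {g : 𝒳 → ℝ}

lemma cusum_nonneg (t : ℕ) (ω : Ω) : 0 ≤ cusum g X t ω := by
  cases t with
  | zero => exact le_rfl
  | succ t => exact cusumStep_nonneg _ _ _

/-- The exponential of the CUSUM chart is a mixture of likelihood ratios. -/
lemma sum_reflectionWeight_mul_likelihoodRatio (t : ℕ) (ω : Ω) :
    ∑ m ∈ Finset.range (t + 1), reflectionWeight g X m ω * likelihoodRatio g X m (t - m) ω
      = ENNReal.ofReal (Real.exp (cusum g X t ω)) := by
  induction t with
  | zero => simp [reflectionWeight, likelihoodRatio, cusum]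
  | succ t ih =>
    rw [Finset.sum_range_succ]
    have h1 : ∑ m ∈ Finset.range (t + 1),
        reflectionWeight g X m ω * likelihoodRatio g X m (t + 1 - m) ω
        = ENNReal.ofReal (Real.exp (cusum g X t ω))
          * ENNReal.ofReal (Real.exp (g (X (t + 1) ω))) := by
      rw [← ih, Finset.sum_mul]
      refine Finset.sum_congr rfl fun m hm => ?_
      rw [Finset.mem_range] at hm
      have h2 : t + 1 - m = (t - m) + 1 := by omega
      have h3 : m + (t - m) + 1 = t + 1 := by omega
      rw [h2, likelihoodRatio, Finset.prod_range_succ, h3, mul_assoc]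
      rfl
    rw [h1, ← ENNReal.ofReal_mul (Real.exp_pos _).le, ← Real.exp_add, Nat.sub_self]
    simp only [likelihoodRatio, Finset.range_zero, Finset.prod_empty, mul_one, reflectionWeight,
      cusum, cusumStep]
    set a := cusum g X t ω + g (X (t + 1) ω)
    -- The new summand is the gap between `exp a` and `max (exp a) 1`.
    rcases le_total 0 a with h | h
    · rw [max_eq_left h, ENNReal.ofReal_of_nonpos (p := 1 - Real.exp a)
        (by linarith [Real.one_le_exp h]), add_zero]
    · have := Real.exp_le_one_iff.2 h
      rw [max_eq_right h, ← ENNReal.ofReal_add (Real.exp_pos _).le (by linarith), Real.exp_zero]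
      congr 1; ring

variable [MeasurableSpace 𝒳]

lemma measurable_cusum (hg : Measurable g) (t : ℕ) :
    Measurable[obsSigma X t] (cusum g X t) := by
  induction t with
  | zero => exact measurable_const
  | succ t ih =>
    exact (measurable_cusumStep_uncurry hg).comp
      ((ih.mono (obsSigma_mono t.le_succ) le_rfl).prodMk (measurable_obs (by omega) le_rfl))

lemma measurable_reflectionWeight (hg : Measurable g) (t : ℕ) :
    Measurable[obsSigma X t] (reflectionWeight g X t) := by
  cases t with
  | zero => exact measurable_const
  | succ t =>
    exact (measurable_const.sub (Real.measurable_exp.comp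
      (((measurable_cusum hg t).mono (obsSigma_mono t.le_succ) le_rfl).add
        (hg.comp (measurable_obs (by omega) le_rfl))))).ennreal_ofReal

lemma measurable_likelihoodRatio (hg : Measurable g) (m i : ℕ) :
    Measurable[obsSigma X (m + i)] (likelihoodRatio g X m i) := by
  refine @Finset.measurable_fun_prod _ _ _ _ _ _ (obsSigma X (m + i)) _ _ fun l hl => ?_
  rw [Finset.mem_range] at hl
  exact (Real.measurable_exp.comp (hg.comp (measurable_obs (by omega) (by omega)))).ennreal_ofReal

variable {Z : ℕ → Ω → Set (Fin 2)} {j : Fin 2}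

lemma measurable_noSignal_one (hZ : IsSignalProcess X Z) (j : Fin 2) (m : ℕ) :
    Measurable[obsSigma X m] (noSignal Z j 1 m) := by
  have h := measurable_noSignal hZ j le_rfl m
  rwa [Nat.add_sub_cancel_left] at h

variable [MeasurableSpace Ω] {F : Fin 2 → Measure 𝒳} {P₀ : Measure Ω} {𝓜 : Set (Measure Ω)}

/-- The delay after a change at time `m + 1`, expressed under the law without change. -/
lemma sum_lintegral_likelihoodRatio_le (h𝓜 : IsModel F X 𝓜)
    (hX : ∀ t, 1 ≤ t → Measurable (X t)) (hg : Measurable g)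
    (hF : F j = (F (1 - j)).withDensity fun x => ENNReal.ofReal (Real.exp (g x)))
    (hP₀ : IsObservationLaw F X P₀) (hlaw : ∀ t, 1 ≤ t → P₀.map (X t) = F (1 - j))
    (hZ : IsSignalProcess X Z) (m N : ℕ) {W : Ω → ℝ≥0∞} (hW : Measurable[obsSigma X m] W) :
    ∑ i ∈ Finset.range N, ∫⁻ ω, W ω * noSignal Z j (m + 1) i ω * likelihoodRatio g X m i ω ∂P₀
      ≤ worstDelay F X 𝓜 Z j * ∫⁻ ω, W ω ∂P₀ := by
  -- One change, at time `m + 1`: this law agrees with `P₀` up to time `m` and enters the supremum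
  -- defining `worstDelay`.
  obtain ⟨P, hP𝓜, hPlaw⟩ := h𝓜.exists_law fun t => if t ≤ m then 1 - j else j
  have hP := h𝓜.isObservationLaw P hP𝓜
  have := hP.isProbabilityMeasure
  have hd : worstMeanDelay X P Z j (m + 1) ≤ worstDelay F X 𝓜 Z j := by
    refine le_iSup_of_le (m + 1) (le_iSup_of_le (by omega) (le_iSup_of_le P
      (le_iSup_of_le hP𝓜 (le_iSup_of_le (fun t ht => ?_) le_rfl))))
    rw [hPlaw t (by omega), if_neg (by omega)]
  have hdelay := lintegral_mul_le_of_condLExp_le (obsSigma_le hX m)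
    (measurable_delay hX hZ j (n := m + 1) (by omega)) hW
    ((ENNReal.ae_le_essSup (μ := P) (condLExp (obsSigma X m) P (delay Z j (m + 1)))).mono
      fun ω hω => hω.trans hd)
  have hchange : ∀ i, ∀ V : Ω → ℝ≥0∞, Measurable[obsSigma X (m + i)] V →
      ∫⁻ ω, V ω ∂P = ∫⁻ ω, V ω * likelihoodRatio g X m i ω ∂P₀ := by
    intro i V hV
    have h := hP.lintegral_eq_lintegral_mul_prod hP₀ hX
      (ρ := fun t => if t < m then 1 else fun x => ENNReal.ofReal (Real.exp (g x))) ?_ ?_ (m + i) hV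
    · rw [h]
      refine lintegral_congr fun ω => ?_
      congr 1
      rw [Finset.prod_range_add, Finset.prod_eq_one, one_mul, likelihoodRatio]
      · refine Finset.prod_congr rfl fun l _ => ?_
        rw [if_neg (by omega)]
      · intro l hl
        rw [if_pos (Finset.mem_range.1 hl)]
        rfl
    · intro t
      split_ifs
      · exact measurable_const
      · exact (Real.measurable_exp.comp hg).ennreal_ofReal
    · intro t
      rw [hPlaw (t + 1) (by omega), hlaw (t + 1) (by omega)]
      by_cases ht : t < m
      · rw [if_pos ht, if_pos (by omega), withDensity_one]
      · rw [if_neg ht, if_neg (by omega), hF]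
  have hT : ∀ i, Measurable[obsSigma X (m + i)] (noSignal Z j (m + 1) i) := fun i => by
    have := measurable_noSignal hZ j (n := m + 1) (by omega) i
    rwa [show m + 1 + i - 1 = m + i by omega] at this
  have hWT : ∀ i, Measurable[obsSigma X (m + i)] fun ω => W ω * noSignal Z j (m + 1) i ω :=
    fun i => (hW.mono (obsSigma_mono (by omega)) le_rfl).mul (hT i)
  calc ∑ i ∈ Finset.range N, ∫⁻ ω, W ω * noSignal Z j (m + 1) i ω * likelihoodRatio g X m i ω ∂P₀
      = ∑ i ∈ Finset.range N, ∫⁻ ω, W ω * noSignal Z j (m + 1) i ω ∂P :=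
        Finset.sum_congr rfl fun i _ => (hchange i _ (hWT i)).symm
    _ = ∫⁻ ω, ∑ i ∈ Finset.range N, W ω * noSignal Z j (m + 1) i ω ∂P :=
        (lintegral_finsetSum _ fun i _ => (hWT i).mono (obsSigma_le hX _) le_rfl).symm
    _ ≤ ∫⁻ ω, W ω * delay Z j (m + 1) ω ∂P := by
        refine lintegral_mono fun ω => ?_
        rw [← Finset.mul_sum, delay_eq_tsum]
        gcongr
        exact ENNReal.sum_le_tsum _
    _ ≤ worstDelay F X 𝓜 Z j * ∫⁻ ω, W ω ∂P := hdelay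
    _ = _ := by
        rw [hchange 0 W hW]
        simp [likelihoodRatio]

/-- Lorden's criterion bounds the accumulated likelihood ratio before the first signal. -/
lemma sum_lintegral_exp_cusum_le (h𝓜 : IsModel F X 𝓜)
    (hX : ∀ t, 1 ≤ t → Measurable (X t)) (hg : Measurable g)
    (hF : F j = (F (1 - j)).withDensity fun x => ENNReal.ofReal (Real.exp (g x)))
    (hP₀ : IsObservationLaw F X P₀) (hlaw : ∀ t, 1 ≤ t → P₀.map (X t) = F (1 - j))
    (hZ : IsSignalProcess X Z) (N : ℕ) :
    ∑ t ∈ Finset.range N, ∫⁻ ω, noSignal Z j 1 t ω * ENNReal.ofReal (Real.exp (cusum g X t ω)) ∂P₀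
      ≤ worstDelay F X 𝓜 Z j *
        ∑ m ∈ Finset.range N, ∫⁻ ω, noSignal Z j 1 m ω * reflectionWeight g X m ω ∂P₀ := by
  have hT := measurable_noSignal_one hZ j
  set f : ℕ → ℕ → ℝ≥0∞ := fun m i =>
    ∫⁻ ω, noSignal Z j 1 (m + i) ω * (reflectionWeight g X m ω * likelihoodRatio g X m i ω) ∂P₀
    with hf
  have h1 : ∀ t, ∫⁻ ω, noSignal Z j 1 t ω * ENNReal.ofReal (Real.exp (cusum g X t ω)) ∂P₀
      = ∑ m ∈ Finset.range (t + 1), f m (t - m) := by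
    intro t
    simp_rw [← sum_reflectionWeight_mul_likelihoodRatio, Finset.mul_sum]
    rw [lintegral_finsetSum]
    · refine Finset.sum_congr rfl fun m hm => ?_
      rw [Finset.mem_range] at hm
      simp only [hf, show m + (t - m) = t by omega]
    · intro m hm
      rw [Finset.mem_range] at hm
      exact ((hT t).mono (obsSigma_le hX _) le_rfl).mul
        (((measurable_reflectionWeight hg m).mono (obsSigma_le hX _) le_rfl).mul
          ((measurable_likelihoodRatio hg m (t - m)).mono (obsSigma_le hX _) le_rfl))
  simp_rw [h1]
  -- Reorder by the change time `m`, which leaves the times `m + i` with `i < N - m`.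
  rw [Finset.sum_range_diag_flip, Finset.mul_sum]
  refine Finset.sum_le_sum fun m _ => ?_
  refine le_trans (le_of_eq ?_) (sum_lintegral_likelihoodRatio_le h𝓜 hX hg hF hP₀ hlaw hZ m (N - m)
    ((hT m).mul (measurable_reflectionWeight hg m)))
  refine Finset.sum_congr rfl fun i _ => lintegral_congr fun ω => ?_
  rw [noSignal_add, add_comm 1 m]
  ring

/-- Once the condition of no signal at the newest time is dropped, integrating out the newest
observation turns the weight into `meanReflection`. The `1` is the term `m = 0`. -/
lemma sum_lintegral_reflectionWeight_le
    (hX : ∀ t, 1 ≤ t → Measurable (X t)) (hg : Measurable g)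
    (hP₀ : IsObservationLaw F X P₀) (hlaw : ∀ t, 1 ≤ t → P₀.map (X t) = F (1 - j))
    (hZ : IsSignalProcess X Z) (N : ℕ) :
    ∑ m ∈ Finset.range N, ∫⁻ ω, noSignal Z j 1 m ω * reflectionWeight g X m ω ∂P₀
      ≤ 1 + ∑ m ∈ Finset.range N,
        ∫⁻ ω, noSignal Z j 1 m ω * meanReflection (F (1 - j)) g (cusum g X m ω) ∂P₀ := by
  have := hP₀.isProbabilityMeasure
  have hT := measurable_noSignal_one hZ j
  have hstep : ∀ m, ∫⁻ ω, noSignal Z j 1 (m + 1) ω * reflectionWeight g X (m + 1) ω ∂P₀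
      ≤ ∫⁻ ω, noSignal Z j 1 m ω * meanReflection (F (1 - j)) g (cusum g X m ω) ∂P₀ := by
    intro m
    have hφ : Measurable[(obsSigma X m).prod inferInstance] fun p : Ω × 𝒳 =>
        noSignal Z j 1 m p.1 * ENNReal.ofReal (1 - Real.exp (cusum g X m p.1 + g p.2)) :=
      ((hT m).comp (@measurable_fst _ _ (obsSigma X m) _)).mul
        (measurable_const.sub (Real.measurable_exp.comp
          (((measurable_cusum hg m).comp (@measurable_fst _ _ (obsSigma X m) _)).add
            (hg.comp (@measurable_snd _ _ (obsSigma X m) _))))).ennreal_ofReal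
    calc _ ≤ ∫⁻ ω, noSignal Z j 1 m ω * reflectionWeight g X (m + 1) ω ∂P₀ := by
          refine lintegral_mono fun ω => ?_
          gcongr
          exact noSignal_succ_le _ _ _
      _ = _ := by
          refine (hP₀.lintegral_obs_succ hX m hφ).trans ?_
          refine lintegral_congr fun ω => ?_
          rw [hlaw (m + 1) (by omega), meanReflection]
          exact lintegral_const_mul (noSignal Z j 1 m ω)
            (f := fun x => ENNReal.ofReal (1 - Real.exp (cusum g X m ω + g x)))
            (measurable_const.sub (measurable_exp_add hg _)).ennreal_ofReal
  cases N with
  | zero => simp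
  | succ N =>
    rw [Finset.sum_range_succ', add_comm]
    refine add_le_add ?_ ?_
    · simp [noSignal_zero, reflectionWeight]
    · refine (Finset.sum_le_sum fun m _ => hstep m).trans ?_
      exact Finset.sum_le_sum_of_subset (Finset.range_subset_range.2 N.le_succ)

/-- Summing the supersolution inequality along the chart up to the first signal. -/
lemma sum_lintegral_supersolution_le
    (hX : ∀ t, 1 ≤ t → Measurable (X t)) (hg : Measurable g)
    (hP₀ : IsObservationLaw F X P₀) (hlaw : ∀ t, 1 ≤ t → P₀.map (X t) = F (1 - j))
    (hZ : IsSignalProcess X Z) {y : ℝ → ℝ≥0∞} (hy : Measurable y) {a lam : ℝ≥0∞}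
    (hsuper : ∀ r, 0 ≤ r → ∫⁻ x, y (cusumStep g r x) ∂(F (1 - j))
      + (a * meanReflection (F (1 - j)) g r + lam) ≤ ENNReal.ofReal (Real.exp r) + y r) (N : ℕ) :
    a * ∑ m ∈ Finset.range N,
        ∫⁻ ω, noSignal Z j 1 m ω * meanReflection (F (1 - j)) g (cusum g X m ω) ∂P₀
      + lam * ∑ m ∈ Finset.range N, ∫⁻ ω, noSignal Z j 1 m ω ∂P₀
      ≤ ∑ m ∈ Finset.range N,
          ∫⁻ ω, noSignal Z j 1 m ω * ENNReal.ofReal (Real.exp (cusum g X m ω)) ∂P₀ + y 0 := by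
  have := hP₀.isProbabilityMeasure
  have hT := fun m => (measurable_noSignal_one hZ j m)
  have hT' := fun m => (hT m).mono (obsSigma_le hX m) le_rfl
  have hR := fun m => (measurable_cusum (X := X) hg m).mono (obsSigma_le hX m) le_rfl
  have hψ : Measurable (meanReflection (F (1 - j)) g) := meanReflection_antitone.measurable
  -- The boundary term with `y` at time `N` is kept so that the sum telescopes, and is discarded at
  -- the end.
  have key : ∀ N, a * ∑ m ∈ Finset.range N,
        ∫⁻ ω, noSignal Z j 1 m ω * meanReflection (F (1 - j)) g (cusum g X m ω) ∂P₀
      + lam * ∑ m ∈ Finset.range N, ∫⁻ ω, noSignal Z j 1 m ω ∂P₀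
      + ∫⁻ ω, noSignal Z j 1 N ω * y (cusum g X N ω) ∂P₀
      ≤ ∑ m ∈ Finset.range N,
          ∫⁻ ω, noSignal Z j 1 m ω * ENNReal.ofReal (Real.exp (cusum g X m ω)) ∂P₀ + y 0 := by
    intro N
    induction N with
    | zero => simp [noSignal_zero, cusum]
    | succ N ih =>
      have h1 : ∫⁻ ω, noSignal Z j 1 (N + 1) ω * y (cusum g X (N + 1) ω) ∂P₀
          ≤ ∫⁻ ω, noSignal Z j 1 N ω * ∫⁻ x, y (cusumStep g (cusum g X N ω) x) ∂(F (1 - j)) ∂P₀ := by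
        rw [← hlaw (N + 1) (by omega),
          ← hP₀.lintegral_mul_comp_cusumStep hX hg (measurable_cusum hg N) (hT N) hy]
        refine lintegral_mono fun ω => ?_
        gcongr
        · exact noSignal_succ_le _ _ _
        · exact le_rfl
      have h2 : ∫⁻ ω, noSignal Z j 1 N ω * ∫⁻ x, y (cusumStep g (cusum g X N ω) x) ∂(F (1 - j)) ∂P₀
          + (a * ∫⁻ ω, noSignal Z j 1 N ω * meanReflection (F (1 - j)) g (cusum g X N ω) ∂P₀
            + lam * ∫⁻ ω, noSignal Z j 1 N ω ∂P₀)
          ≤ ∫⁻ ω, noSignal Z j 1 N ω * ENNReal.ofReal (Real.exp (cusum g X N ω)) ∂P₀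
            + ∫⁻ ω, noSignal Z j 1 N ω * y (cusum g X N ω) ∂P₀ := by
        have hm1 : Measurable fun ω =>
            noSignal Z j 1 N ω * meanReflection (F (1 - j)) g (cusum g X N ω) :=
          (hT' N).mul (hψ.comp (hR N))
        have hm2 : Measurable fun ω => a *
            (noSignal Z j 1 N ω * meanReflection (F (1 - j)) g (cusum g X N ω)) :=
          hm1.const_mul a
        have hm3 : Measurable fun ω => lam * noSignal Z j 1 N ω := (hT' N).const_mul lam
        have hm4 : Measurable fun ω => noSignal Z j 1 N ω * y (cusum g X N ω) :=
          (hT' N).mul (hy.comp (hR N))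
        have hm5 : Measurable fun ω =>
            a * (noSignal Z j 1 N ω * meanReflection (F (1 - j)) g (cusum g X N ω))
              + lam * noSignal Z j 1 N ω := hm2.add hm3
        rw [← lintegral_const_mul a hm1, ← lintegral_const_mul lam (hT' N),
          ← lintegral_add_left hm2, ← lintegral_add_right _ hm5, ← lintegral_add_right _ hm4]
        refine lintegral_mono fun ω => ?_
        have := mul_le_mul_right (hsuper _ (cusum_nonneg (g := g) (X := X) N ω))
          (noSignal Z j 1 N ω)
        refine le_trans (le_of_eq ?_) (this.trans (le_of_eq ?_))
        · ring
        · ring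
      simp only [Finset.sum_range_succ, mul_add]
      calc _ ≤ _ := add_le_add_right h1 _
        _ = a * ∑ m ∈ Finset.range N,
              ∫⁻ ω, noSignal Z j 1 m ω * meanReflection (F (1 - j)) g (cusum g X m ω) ∂P₀
            + lam * ∑ m ∈ Finset.range N, ∫⁻ ω, noSignal Z j 1 m ω ∂P₀
            + (∫⁻ ω, noSignal Z j 1 N ω * ∫⁻ x, y (cusumStep g (cusum g X N ω) x) ∂(F (1 - j)) ∂P₀
          + (a * ∫⁻ ω, noSignal Z j 1 N ω * meanReflection (F (1 - j)) g (cusum g X N ω) ∂P₀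
            + lam * ∫⁻ ω, noSignal Z j 1 N ω ∂P₀)) := by ring
        _ ≤ _ := add_le_add_right h2 _
        _ = _ := add_left_comm _ _ _
        _ ≤ _ := add_le_add_right ih _
        _ = _ := by ring
  exact le_self_add.trans (key N)

/-- Moustakides' bound: among all signal processes with the same mean time to a false signal, the
CUSUM chart has the least worst mean delay. -/
theorem meanExit_le_worstDelay [∀ j, IsProbabilityMeasure (F j)] (h𝓜 : IsModel F X 𝓜)
    (hX : ∀ t, 1 ≤ t → Measurable (X t)) (hg : Measurable g)
    (hF : F j = (F (1 - j)).withDensity fun x => ENNReal.ofReal (Real.exp (g x)))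
    (hpos : 0 < F (1 - j) {x | 0 < g x}) (hneg : 0 < F (1 - j) {x | g x < 0})
    {k : ℝ} (hk : 0 < k) (hZ : IsSignalProcess X Z)
    (hrun : meanExit (F (1 - j)) g k 0 ≤ runLength F X 𝓜 Z j) :
    meanExit (F j) g k 0 ≤ worstDelay F X 𝓜 Z j := by
  by_contra! hlt
  obtain ⟨P₀, hP𝓜, hlaw⟩ := h𝓜.exists_law fun _ => 1 - j
  have hP₀ := h𝓜.isObservationLaw P₀ hP𝓜
  have := hP₀.isProbabilityMeasure
  obtain ⟨lam, y, hlam, hy, hy0, hsuper⟩ := exists_supersolution hg hF hpos hneg hk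
  set d := worstDelay F X 𝓜 Z j with hd
  set c := meanExit (F (1 - j)) g k 0 with hc
  have hcfin : c ≠ ∞ := (meanExit_lt_top hg hpos hk le_rfl).ne
  -- At `n = 1` the past is trivial, so the run-length constraint bounds a plain expectation.
  have hdelay : c ≤ ∑' m, ∫⁻ ω, noSignal Z j 1 m ω ∂P₀ := by
    have h1 : c ≤ worstMeanDelay X P₀ Z j 1 :=
      hrun.trans ((iInf₂_le 1 le_rfl).trans ((iInf₂_le P₀ hP𝓜).trans (iInf_le _ hlaw)))
    rw [worstMeanDelay, Nat.sub_self, obsSigma_zero, condLExp_bot] at h1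
    rw [← lintegral_tsum fun m =>
      ((measurable_noSignal_one hZ j m).mono (obsSigma_le hX m) le_rfl).aemeasurable]
    simp_rw [← delay_eq_tsum]
    exact h1.trans (essSup_le_of_ae_le _ (Eventually.of_forall fun _ => le_rfl))
  obtain ⟨ε, hε⟩ := exists_add_of_le hlt.le
  have hdfin : d ≠ ∞ := hlt.ne_top
  have hε0 : ε ≠ 0 := by
    rintro rfl
    rw [add_zero] at hε
    exact hlt.ne hε.symm
  -- Here `ε` is the supposed gain over CUSUM. Truncation at `N` keeps `Q` finite, so that `d * (1 +
  -- Q)` can be cancelled.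
  have hN : ∀ N, ε + lam * ∑ m ∈ Finset.range N, ∫⁻ ω, noSignal Z j 1 m ω ∂P₀ ≤ lam * c := by
    intro N
    have h1 := sum_lintegral_supersolution_le hX hg hP₀ hlaw hZ hy hsuper N
    have h2 := sum_lintegral_exp_cusum_le h𝓜 hX hg hF hP₀ hlaw hZ N
    have h3 := sum_lintegral_reflectionWeight_le hX hg hP₀ hlaw hZ N
    set S := ∑ m ∈ Finset.range N, ∫⁻ ω, noSignal Z j 1 m ω ∂P₀
    set Q := ∑ m ∈ Finset.range N,
        ∫⁻ ω, noSignal Z j 1 m ω * meanReflection (F (1 - j)) g (cusum g X m ω) ∂P₀ with hQ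
    have hQfin : Q ≠ ∞ := by
      refine (ENNReal.sum_lt_top.2 fun m _ => ?_).ne
      calc _ ≤ ∫⁻ _, 1 ∂P₀ := lintegral_mono fun ω =>
            mul_le_one' (noSignal_le_one _ _ _) (meanReflection_le_one _)
        _ < ∞ := by simp
    have h4 := h1.trans (add_le_add_left (h2.trans (mul_le_mul_right h3 d)) (y 0))
    have h5 : d * (1 + Q) + (ε * (1 + Q) + lam * S) ≤ d * (1 + Q) + lam * c := by
      rw [← hy0]
      calc _ = (d + ε) * Q + lam * S + (d + ε) := by ring
        _ = meanExit (F j) g k 0 * Q + lam * S + meanExit (F j) g k 0 := by rw [← hε]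
        _ ≤ d * (1 + Q) + y 0 + meanExit (F j) g k 0 := add_le_add_left h4 _
        _ = _ := by ring
    have h6 := (ENNReal.add_le_add_iff_left (ENNReal.mul_ne_top hdfin
      (ENNReal.add_ne_top.2 ⟨ENNReal.one_ne_top, hQfin⟩))).1 h5
    refine le_trans (add_le_add_left ?_ _) h6
    rw [mul_add, mul_one]
    exact le_self_add
  -- Let `N → ∞` and use that the mean time to a false signal is at least `c`.
  have hlim : ε + lam * c ≤ lam * c := by
    have h1 : ε + lam * ∑' m, ∫⁻ ω, noSignal Z j 1 m ω ∂P₀ ≤ lam * c := by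
      rw [ENNReal.tsum_eq_iSup_nat, ENNReal.mul_iSup, ENNReal.add_iSup]
      exact iSup_le hN
    exact le_trans (add_le_add_right (mul_le_mul_right hdelay _) _) h1
  have hfin : lam * c ≠ ∞ := ENNReal.mul_ne_top hlam hcfin
  have : ε + lam * c ≤ 0 + lam * c := by rwa [zero_add]
  exact hε0 (nonpos_iff_eq_zero.1 ((ENNReal.add_le_add_iff_right hfin).1 this))

end Cusum
-- Optimality of one signal, and null sets of the chart.
section Threshold

variable {Ω 𝒳 : Type*} [MeasurableSpace Ω] [MeasurableSpace 𝒳] {F : Fin 2 → Measure 𝒳}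
  {X : ℕ → Ω → 𝒳} {𝓜 : Set (Measure Ω)} {g : 𝒳 → ℝ}

/-- Signalling `j` when the CUSUM chart reaches a suitable threshold is optimal for the signal
`j`, under a constraint on the time to a false signal `j`. -/
theorem exists_optimal_threshold [∀ j, IsProbabilityMeasure (F j)] (h𝓜 : IsModel F X 𝓜)
    (hX : ∀ t, 1 ≤ t → Measurable (X t)) {i j : Fin 2} (hij : 1 - j = i) (hg : Measurable g)
    (hF : F j = (F i).withDensity fun x => ENNReal.ofReal (Real.exp (g x)))
    (hatom : ∀ a, F i {x | g x = a} = 0) (hneg : 0 < F i {x | g x < 0}) {c : ℝ}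
    (hc : 1 < ENNReal.ofReal c * F i {x | 0 < g x}) :
    ∃ k > 0, ∀ h, k ≤ h → ∀ Z, IsSignalProcess X Z →
      (∀ P ∈ 𝓜, ∀ᵐ ω ∂P, ∀ t, 1 ≤ t → (j ∈ Z t ω ↔ k ≤ cappedCusum g X h t ω)) →
      ENNReal.ofReal c ≤ runLength F X 𝓜 Z j ∧
        ∀ Z', IsSignalProcess X Z' → ENNReal.ofReal c ≤ runLength F X 𝓜 Z' j →
          worstDelay F X 𝓜 Z j ≤ worstDelay F X 𝓜 Z' j := by
  subst hij
  obtain ⟨k, hk, hkc⟩ := exists_threshold_meanExit_eq hg hatom hc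
  have hpos : 0 < F (1 - j) {x | 0 < g x} := by
    refine pos_iff_ne_zero.2 fun h => ?_
    simp [h] at hc
  -- The threshold depends on `c` alone and not on `h`; `Z` need only follow it almost surely, which
  -- the single-valued process uses.
  refine ⟨k, hk, fun h hkh Z hZs hZ => ⟨?_, fun Z' hZ's hrun => ?_⟩⟩
  · refine le_iInf₂ fun n hn => le_iInf₂ fun P hP => le_iInf fun hlaw => ?_
    obtain ⟨m, rfl⟩ : ∃ m, n = m + 1 := ⟨n - 1, by omega⟩
    rw [← hkc]
    exact (h𝓜.isObservationLaw P hP).le_worstMeanDelay hX hg hkh (hk.le.trans hkh) hZs (hZ P hP)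
      hneg hlaw m
  · refine le_trans ?_ (meanExit_le_worstDelay h𝓜 hX hg hF hpos hneg hk hZ's (hkc.le.trans hrun))
    refine iSup₂_le fun n hn => iSup₂_le fun P hP => iSup_le fun hlaw => ?_
    obtain ⟨m, rfl⟩ : ∃ m, n = m + 1 := ⟨n - 1, by omega⟩
    exact (h𝓜.isObservationLaw P hP).worstMeanDelay_le hX hg hkh (hk.le.trans hkh) hZs (hZ P hP)
      hlaw

/-- Strictly between the barriers a value is reached only through `r + g x = κ`, which is null under
either law of the newest observation. -/
lemma IsObservationLaw.ae_cappedCusum_ne {P : Measure Ω} (hP : IsObservationLaw F X P)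
    (hX : ∀ t, 1 ≤ t → Measurable (X t)) (hg : Measurable g)
    (hatom : ∀ i a, F i {x | g x = a} = 0) {h κ : ℝ} (hκ : 0 < κ) (hκh : κ < h) {t : ℕ}
    (ht : 1 ≤ t) : ∀ᵐ ω ∂P, cappedCusum g X h t ω ≠ κ := by
  obtain ⟨m, rfl⟩ : ∃ m, t = m + 1 := ⟨t - 1, by omega⟩
  have hf : Measurable (({κ} : Set ℝ).indicator fun _ => (1 : ℝ≥0∞)) :=
    measurable_const.indicator (measurableSet_singleton κ)
  have hstep := hP.lintegral_mul_comp_cusumStep hX hg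
    (measurable_cappedCusum (X := X) (h := h) hg m)
    (W := fun _ => 1) measurable_const hf
  obtain ⟨i, hi⟩ := hP.law (m + 1) (by omega)
  have hzero : ∀ r, ∫⁻ x, ({κ} : Set ℝ).indicator (fun _ => (1 : ℝ≥0∞)) (cusumStep g r x) ∂(F i)
      = 0 := by
    intro r
    refine (lintegral_eq_zero_iff (hf.comp (measurable_cusumStep hg r))).2 ?_
    have hne : ∀ᵐ x ∂(F i), g x ≠ κ - r := by
      rw [ae_iff]; simpa using hatom i (κ - r)
    filter_upwards [hne] with x hx
    refine indicator_of_notMem (fun hmem => hx ?_) _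
    have hmem' : max (r + g x) 0 = κ := hmem
    rcases max_choice (r + g x) 0 with h' | h' <;> rw [h'] at hmem'
    · linarith
    · exact absurd hmem' hκ.ne
  rw [hi] at hstep
  simp only [hzero, mul_zero, lintegral_zero, one_mul] at hstep
  have hae := (lintegral_eq_zero_iff (hf.comp ((measurable_cusumStep_uncurry hg).comp
    (((measurable_cappedCusum hg m).mono (obsSigma_le hX m) le_rfl).prodMk
      (hX (m + 1) (by omega)))))).1 hstep
  filter_upwards [hae] with ω hω heq
  have heq' : min (cusumStep g (cappedCusum g X h m ω) (X (m + 1) ω)) h = κ := heq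
  rcases min_choice (cusumStep g (cappedCusum g X h m ω) (X (m + 1) ω)) h with h' | h' <;>
    rw [h'] at heq'
  · simp [heq'] at hω
  · exact hκh.ne' heq'

end Threshold

/-! ### The charts of the statement in terms of `cappedCusum`. -/

section Chart

variable {Ω 𝒳 : Type*} [MeasurableSpace 𝒳] (F : Fin 2 → Measure 𝒳) (X : ℕ → Ω → 𝒳)

lemma chart_zero_eq_cappedCusum (h : ℝ) (t : ℕ) (ω : Ω) :
    chart F X h 0 t ω = cappedCusum (llr (F 1) (F 0)) X h t ω := by
  induction t with
  | zero => rfl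
  | succ t ih => simp only [chart, cappedCusum, cusumStep, ih]

/-- The map `r ↦ h - r` swaps the two barriers and reverses the score. -/
lemma chart_self_eq_sub_cappedCusum {h : ℝ} (hh : 0 ≤ h) (t : ℕ) (ω : Ω) :
    chart F X h h t ω = h - cappedCusum (fun x => - llr (F 1) (F 0) x) X h t ω := by
  induction t with
  | zero => simp [chart, cappedCusum]
  | succ t ih =>
    simp only [chart, cappedCusum, cusumStep, ih]
    set a := cappedCusum (fun x => - llr (F 1) (F 0) x) X h t ω
    set l := llr (F 1) (F 0) (X (t + 1) ω)
    rcases le_total (a + -l) 0 with h1 | h1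
    · rw [max_eq_right h1, min_eq_left hh, max_eq_left (by linarith), min_eq_right (by linarith)]
      ring
    · rw [max_eq_left h1]
      rcases le_total (a + -l) h with h2 | h2
      · rw [min_eq_left h2, max_eq_left (by linarith), min_eq_left (by linarith)]
        ring
      · rw [min_eq_right h2, max_eq_right (by linarith), min_eq_left hh]
        ring

lemma chart_mono {h r r' : ℝ} (hr : r ≤ r') (t : ℕ) (ω : Ω) :
    chart F X h r t ω ≤ chart F X h r' t ω := by
  induction t with
  | zero => exact hr
  | succ t ih =>
    exact min_le_min_right _ (max_le_max_right _ (by linarith))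

lemma measurable_chart (h r : ℝ) (t : ℕ) : Measurable[obsSigma X t] (chart F X h r t) := by
  induction t with
  | zero => exact measurable_const
  | succ t ih =>
    exact (((ih.mono (obsSigma_mono t.le_succ) le_rfl).add
      ((measurable_llr (F 1) (F 0)).comp (measurable_obs (by omega) le_rfl))).max
        measurable_const).min measurable_const

variable {F X} {kU kL h : ℝ} {t : ℕ} {ω : Ω}

lemma zero_mem_twoChartSignal :
    0 ∈ twoChartSignal F X kU kL h t ω ↔ chart F X h h t ω ≤ h - kU := by
  simp [twoChartSignal]

lemma one_mem_twoChartSignal :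
    1 ∈ twoChartSignal F X kU kL h t ω ↔ kL ≤ chart F X h 0 t ω := by
  simp [twoChartSignal]

lemma zero_mem_twoChartSingleSignal :
    0 ∈ twoChartSingleSignal F X kU kL h t ω ↔ chart F X h h t ω ≤ h - kU := by
  unfold twoChartSingleSignal
  split_ifs <;> simp_all

lemma one_mem_twoChartSingleSignal :
    1 ∈ twoChartSingleSignal F X kU kL h t ω ↔
      ¬ chart F X h h t ω ≤ h - kU ∧ kL ≤ chart F X h 0 t ω := by
  unfold twoChartSingleSignal
  split_ifs <;> simp_all

lemma isSingleSignal_twoChartSingleSignal :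
    IsSingleSignal (twoChartSingleSignal F X kU kL h) := by
  intro t _ ω
  unfold twoChartSingleSignal
  split_ifs <;> simp

lemma isSignalProcess_twoChartSignal : IsSignalProcess X (twoChartSignal F X kU kL h) := by
  intro t _ j
  fin_cases j
  · simp only [Fin.zero_eta, zero_mem_twoChartSignal]
    exact measurable_chart F X h h t measurableSet_Iic
  · simp only [Fin.mk_one, one_mem_twoChartSignal]
    exact measurable_chart F X h 0 t measurableSet_Ici

lemma isSignalProcess_twoChartSingleSignal :
    IsSignalProcess X (twoChartSingleSignal F X kU kL h) := by
  intro t _ j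
  fin_cases j
  · simp only [Fin.zero_eta, zero_mem_twoChartSingleSignal]
    exact measurable_chart F X h h t measurableSet_Iic
  · simp only [Fin.mk_one, one_mem_twoChartSingleSignal]
    exact (measurable_chart F X h h t measurableSet_Iic).compl.inter
      (measurable_chart F X h 0 t measurableSet_Ici)

end Chart

/-! ### From the density to the log-likelihood ratio. -/

section LogLikelihood

variable {𝒳 : Type*} [MeasurableSpace 𝒳] {μ ν : Measure 𝒳}

lemma measure_llr_eq_zero (hatom : ∀ a, μ {x | ν.rnDeriv μ x = a} = 0) (a : ℝ) :
    μ {x | llr ν μ x = a} = 0 := by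
  -- Densities `0` and `∞` both have `llr` equal to `0` by convention, so they are covered
  -- separately.
  have hsub : {x | llr ν μ x = a} ⊆ ({x | ν.rnDeriv μ x = 0} ∪ {x | ν.rnDeriv μ x = ∞})
      ∪ {x | ν.rnDeriv μ x = ENNReal.ofReal (Real.exp a)} := by
    intro x hx
    have hx' : Real.log (ν.rnDeriv μ x).toReal = a := hx
    by_cases h0 : ν.rnDeriv μ x = 0
    · exact Or.inl (Or.inl h0)
    by_cases htop : ν.rnDeriv μ x = ∞
    · exact Or.inl (Or.inr htop)
    · refine Or.inr ?_
      change ν.rnDeriv μ x = _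
      rw [← hx', Real.exp_log (ENNReal.toReal_pos h0 htop), ENNReal.ofReal_toReal htop]
  exact measure_mono_null hsub
    (measure_union_null (measure_union_null (hatom 0) (hatom ∞)) (hatom _))

variable [IsProbabilityMeasure ν]

lemma measure_one_lt_rnDeriv_le :
    μ {x | 1 < ν.rnDeriv μ x} ≤ μ {x | 0 < llr ν μ x} := by
  refine measure_mono_ae ?_
  filter_upwards [Measure.rnDeriv_lt_top ν μ] with x h1 h2
  have h2' : 1 < ν.rnDeriv μ x := h2
  refine Real.log_pos ?_
  rw [← ENNReal.toReal_one]
  exact (ENNReal.toReal_lt_toReal ENNReal.one_ne_top h1.ne).2 h2'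

variable [IsProbabilityMeasure μ]

lemma measure_rnDeriv_lt_one_le (hνμ : ν ≪ μ) :
    ν {x | ν.rnDeriv μ x < 1} ≤ ν {x | 0 < - llr ν μ x} := by
  refine measure_mono_ae ?_
  filter_upwards [Measure.rnDeriv_pos hνμ] with x h1 h2
  have h2' : ν.rnDeriv μ x < 1 := h2
  refine neg_pos.2 (Real.log_neg (ENNReal.toReal_pos h1.ne' h2'.ne_top) ?_)
  rw [← ENNReal.toReal_one]
  exact (ENNReal.toReal_lt_toReal h2'.ne_top ENNReal.one_ne_top).2 h2'

lemma eq_withDensity_exp_llr (hμν : μ ≪ ν) (hνμ : ν ≪ μ) :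
    ν = μ.withDensity fun x => ENNReal.ofReal (Real.exp (llr ν μ x)) := by
  rw [← Measure.withDensity_rnDeriv_eq ν μ hνμ]
  refine withDensity_congr_ae ?_
  rw [Measure.withDensity_rnDeriv_eq ν μ hνμ]
  filter_upwards [exp_llr_of_ac' ν μ hμν, Measure.rnDeriv_lt_top ν μ] with x h1 h2
  rw [h1, ENNReal.ofReal_toReal h2.ne]

lemma eq_withDensity_exp_neg_llr (hνμ : ν ≪ μ) (hμν : μ ≪ ν) :
    μ = ν.withDensity fun x => ENNReal.ofReal (Real.exp (- llr ν μ x)) := by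
  conv_lhs => rw [← Measure.withDensity_rnDeriv_eq μ ν hμν]
  refine withDensity_congr_ae ?_
  filter_upwards [exp_neg_llr hνμ, Measure.rnDeriv_lt_top μ ν] with x h1 h2
  rw [h1, ENNReal.ofReal_toReal h2.ne]

end LogLikelihood

end SignalDetection

/-! ### The theorem: both one-signal results combined. -/

theorem theorem1 {Ω 𝒳 : Type*} [MeasurableSpace Ω] [MeasurableSpace 𝒳]
    (F : Fin 2 → Measure 𝒳) [∀ j, IsProbabilityMeasure (F j)]
    (hF₀₁ : F 0 ≪ F 1) (hF₁₀ : F 1 ≪ F 0)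
    (hatoms : ∀ a, F 0 {x | (F 1).rnDeriv (F 0) x = a} = 0)
    (X : ℕ → Ω → 𝒳) (hX : ∀ t, 1 ≤ t → Measurable (X t))
    (𝓜 : Set (Measure Ω)) (h𝓜 : SignalDetection.IsModel F X 𝓜)
    (c₀ c₁ : ℝ)
    (hc₀ : 1 < ENNReal.ofReal c₀ * F 1 {x | (F 1).rnDeriv (F 0) x < 1})
    (hc₁ : 1 < ENNReal.ofReal c₁ * F 0 {x | 1 < (F 1).rnDeriv (F 0) x}) :
    ∃ kU kL : ℝ, 0 < kU ∧ 0 < kL ∧ ∀ h : ℝ, max kU kL ≤ h →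
      SignalDetection.IsSolution F X 𝓜 c₀ c₁
        {Z | SignalDetection.IsSignalProcess X Z}
        (SignalDetection.twoChartSignal F X kU kL h) ∧
      (h ≤ kU + kL →
        SignalDetection.IsSolution F X 𝓜 c₀ c₁
          {Z | SignalDetection.IsSignalProcess X Z ∧ SignalDetection.IsSingleSignal Z}
          (SignalDetection.twoChartSingleSignal F X kU kL h)) := by
  open SignalDetection in
  set g : 𝒳 → ℝ := llr (F 1) (F 0) with hgdef
  have hg : Measurable g := measurable_llr _ _
  have hat0 : ∀ a, F 0 {x | g x = a} = 0 := measure_llr_eq_zero hatoms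
  have hat1 : ∀ a, F 1 {x | g x = a} = 0 := fun a => hF₁₀ (hat0 a)
  have hat : ∀ (i : Fin 2) (a : ℝ), F i {x | g x = a} = 0 := by
    intro i a
    fin_cases i
    exacts [hat0 a, hat1 a]
  have hc₁' : 1 < ENNReal.ofReal c₁ * F 0 {x | 0 < g x} :=
    hc₁.trans_le (mul_le_mul_right measure_one_lt_rnDeriv_le _)
  have hc₀' : 1 < ENNReal.ofReal c₀ * F 1 {x | 0 < - g x} :=
    hc₀.trans_le (mul_le_mul_right (measure_rnDeriv_lt_one_le hF₁₀) _)
  -- Downward moves under `F 0` come from the condition on the other signal's constant `c₀`, through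
  -- absolute continuity.
  have hneg0 : 0 < F 0 {x | g x < 0} := by
    refine pos_iff_ne_zero.2 fun h => ?_
    have h' : F 1 {x | 0 < - g x} = 0 := hF₁₀ (by simpa using h)
    rw [h', mul_zero] at hc₀'
    exact not_lt_zero hc₀'
  have hneg1 : 0 < F 1 {x | - g x < 0} := by
    refine pos_iff_ne_zero.2 fun h => ?_
    have h' : F 0 {x | 0 < g x} = 0 := hF₀₁ (by simpa using h)
    rw [h', mul_zero] at hc₁'
    exact not_lt_zero hc₁'
  obtain ⟨kL, hkL, hL⟩ := exists_optimal_threshold h𝓜 hX (i := 0) (j := 1) (by decide) hg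
    (eq_withDensity_exp_llr hF₀₁ hF₁₀) hat0 hneg0 hc₁'
  obtain ⟨kU, hkU, hU⟩ := exists_optimal_threshold h𝓜 hX (i := 1) (j := 0) (by decide) hg.neg
    (eq_withDensity_exp_neg_llr hF₁₀ hF₀₁)
    (fun a => by simpa [neg_eq_iff_eq_neg] using hat1 (-a)) hneg1 hc₀'
  refine ⟨kU, kL, hkU, hkL, fun h hh => ?_⟩
  have hUh : kU ≤ h := (le_max_left _ _).trans hh
  have hLh : kL ≤ h := (le_max_right _ _).trans hh
  have hh0 : 0 ≤ h := hkL.le.trans hLh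
  have hiff0 : ∀ t ω, chart F X h h t ω ≤ h - kU ↔ kU ≤ cappedCusum (fun x => - g x) X h t ω := by
    intro t ω
    rw [chart_self_eq_sub_cappedCusum F X hh0]
    constructor <;> intro h' <;> linarith
  refine ⟨?_, fun hhle => ?_⟩
  · obtain ⟨h0, h0'⟩ := hU h hUh (twoChartSignal F X kU kL h) isSignalProcess_twoChartSignal
      (fun P _ => Filter.Eventually.of_forall fun ω t _ =>
        zero_mem_twoChartSignal.trans (hiff0 t ω))
    obtain ⟨h1, h1'⟩ := hL h hLh (twoChartSignal F X kU kL h) isSignalProcess_twoChartSignal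
      (fun P _ => Filter.Eventually.of_forall fun ω t _ => by
        rw [one_mem_twoChartSignal, chart_zero_eq_cappedCusum])
    exact ⟨⟨isSignalProcess_twoChartSignal, h0, h1⟩, fun Z' hZ' =>
      ⟨h1' Z' hZ'.1 hZ'.2.2, h0' Z' hZ'.1 hZ'.2.1⟩⟩
  -- A conflict gives `kL ≤ R^L ≤ R^U ≤ h - kU ≤ kL`. If `kL < h` then `R^L = kL` is null; otherwise
  -- `kL = h` and `h - kU < kL` excludes it outright.
  · have hconf : ∀ P ∈ 𝓜, ∀ᵐ ω ∂P, ∀ t, 1 ≤ t →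
        ¬ (chart F X h h t ω ≤ h - kU ∧ kL ≤ chart F X h 0 t ω) := by
      intro P hP
      refine MeasureTheory.ae_all_iff.2 fun t => ?_
      by_cases ht : 1 ≤ t
      swap
      · exact Filter.Eventually.of_forall fun ω ht' => absurd ht' ht
      by_cases hκ : kL < h
      · filter_upwards [(h𝓜.isObservationLaw P hP).ae_cappedCusum_ne hX hg hat hkL hκ ht]
          with ω hω _ hcon
        refine hω (le_antisymm ?_ ?_)
        · rw [← chart_zero_eq_cappedCusum]
          linarith [chart_mono F X (h := h) hh0 t ω]
        · rw [← chart_zero_eq_cappedCusum]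
          exact hcon.2
      · refine Filter.Eventually.of_forall fun ω _ hcon => ?_
        linarith [chart_mono F X (h := h) hh0 t ω]
    obtain ⟨h0, h0'⟩ := hU h hUh (twoChartSingleSignal F X kU kL h)
      isSignalProcess_twoChartSingleSignal
      (fun P _ => Filter.Eventually.of_forall fun ω t _ =>
        zero_mem_twoChartSingleSignal.trans (hiff0 t ω))
    obtain ⟨h1, h1'⟩ := hL h hLh (twoChartSingleSignal F X kU kL h)
      isSignalProcess_twoChartSingleSignal
      (fun P hP => by
        filter_upwards [hconf P hP] with ω hω t ht
        rw [one_mem_twoChartSingleSignal, ← chart_zero_eq_cappedCusum]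
        exact ⟨fun h' => h'.2, fun h' => ⟨fun h'' => hω t ht ⟨h'', h'⟩, h'⟩⟩)
    exact ⟨⟨⟨isSignalProcess_twoChartSingleSignal, isSingleSignal_twoChartSingleSignal⟩, h0, h1⟩,
      fun Z' hZ' => ⟨h1' Z' hZ'.1.1 hZ'.2.2, h0' Z' hZ'.1.1 hZ'.2.1⟩⟩
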